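/- Let $V$ be a finite-dimensional complex vector space and let $S^dV$ be the space of homogeneous polynomials of degree $d$ on $V^*$. For $P\in S^dV$ the symmetric rank $R_s(P)$ is the least $r\in\mathbb{N}$ such that $P=\sum_{i=1}^r v_i^d$ with $v_1,\dots,v_r\in V$, and the symmetric border rank $\underline{R}_s(P)$ is the least $r\in\mathbb{N}$ such that $P$ lies in the Zariski closure, in $S^dV$, of $\{T\in S^dV: R_s(T)=r\}$. Let $\det_n\in S^n(\mathbb{C}^{n\times n})$ denote the determinant of the generic $n\times n$ matrix, a homogeneous polynomial of degree $n$ in the $n^2$ matrix entries. Let $n\ge 5$. Then $\underline{R}_s(\det_n)$ is a (finite) natural number. If $n$ is even, then \[ \underline{R}_s(\textstyle\det_n)\;\ge\;\left(1+\frac{8(n^3+6n^2-8)}{(n-1)(n+2)(n+4)^2(n^2-2)}\right)\binom{n}{n/2}^2, \] and if $n$ is odd, then \[ \underline{R}_s(\textstyle\det_n)\;\ge\;\left(1+\frac{16(n^2+8n+9)}{(n+3)(n+5)^2(n^2-2)}\right)\binom{n}{(n-1)/2}^2. \] -/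

import Mathlib

noncomputable section

open MvPolynomial

/-- `S^d V` for the complex vector space `V` with basis `σ`: the homogeneous polynomials of
degree `d` in the variables `σ`. In particular `SymPow σ 1` is `V` itself, the linear forms. -/
abbrev SymPow (σ : Type*) (d : ℕ) : Submodule ℂ (MvPolynomial σ ℂ) :=
  homogeneousSubmodule σ ℂ d

/-- The polynomial functions on a complex vector space: the algebra of functions generated by
the linear functionals. -/
def polyFunctions (W : Type*) [AddCommGroup W] [Module ℂ W] : Subalgebra ℂ (W → ℂ) :=
  Algebra.adjoin ℂ (Set.range fun φ : Module.Dual ℂ W => (φ : W → ℂ))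

/-- The Zariski closure of a subset `S` of a complex vector space: the common zeros of all
polynomial functions that vanish on `S`. -/
def zariskiClosure {W : Type*} [AddCommGroup W] [Module ℂ W] (S : Set W) : Set W :=
  {w | ∀ F ∈ polyFunctions W, (∀ s ∈ S, F s = 0) → F w = 0}

/-- The symmetric rank of `P ∈ S^d V`: the least `r` such that `P` is a sum of `r` `d`-th powers
of elements of `V` (`⊤` if there is no such `r`). -/
def symmetricRank {σ : Type*} {d : ℕ} (P : SymPow σ d) : ℕ∞ :=
  sInf ((fun r : ℕ => (r : ℕ∞)) ''
    {r : ℕ | ∃ v : Fin r → SymPow σ 1,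
      (P : MvPolynomial σ ℂ) = ∑ i, (v i : MvPolynomial σ ℂ) ^ d})

/-- The symmetric border rank of `P ∈ S^d V`: the least `r` such that `P` lies in the Zariski
closure, in `S^d V`, of the set of forms of symmetric rank `r` (`⊤` if there is no such `r`). -/
def symmetricBorderRank {σ : Type*} {d : ℕ} (P : SymPow σ d) : ℕ∞ :=
  sInf ((fun r : ℕ => (r : ℕ∞)) ''
    {r : ℕ | P ∈ zariskiClosure {T : SymPow σ d | symmetricRank T = (r : ℕ∞)}})

/-- The determinant of the generic `n × n` matrix, a form of degree `n` in the `n²` entries. -/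
def detForm (n : ℕ) : SymPow (Fin n × Fin n) n :=
  ⟨(Matrix.mvPolynomialX (Fin n) (Fin n) ℂ).det, by
    rw [mem_homogeneousSubmodule, Matrix.det_apply]
    refine IsHomogeneous.sum _ _ _ fun τ _ => ?_
    rw [← mem_homogeneousSubmodule, Units.smul_def]
    refine zsmul_mem ?_ _
    rw [mem_homogeneousSubmodule]
    have h := IsHomogeneous.prod (Finset.univ : Finset (Fin n))
      (fun i => Matrix.mvPolynomialX (Fin n) (Fin n) ℂ (τ i) i) (fun _ => 1)
      (fun i _ => isHomogeneous_X ℂ (τ i, i))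
    simpa using h⟩

end

/-! The bound comes from a Koszul flattening. Let N = n² be the number of variables and k + 1 + l =
n. A form P gives a map sending f ⊗ a∧b∧c, with deg f = l, to (X_a f)(∂)P ⊗ b∧c − (X_b f)(∂)P ⊗ a∧c
+ (X_c f)(∂)P ⊗ a∧b; `koszulMatrix` is this map tested on squarefree operators only. For P = vⁿ it
factors through contraction with v on Λ³, so its rank is at most C(N−1, 2). Rank is subadditive, and
bounded rank is a Zariski closed condition, so the rank at det_n is at most C(N−1, 2) times the
border rank.

For the lower bound, consider the brackets f(∂)det ⊗ a∧b with f squarefree of degree l + 1. They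
span a space of dimension at least C(n, l+1)² C(N, 2) (`linearIndependent_detBracket`). Modulo the
rows of the matrix, one bracket for each normal form suffices (`detBracket_mem`), a normal form
being a pair (E, b) with E a chain of l + 2 cells and b a cell not strictly to the upper left of all
of E. There are at most n² C(n, l+2)² − C(n, l+3)² of these (`card_normalForms_le`), and the
difference bounds the rank from below (`le_rank_koszulMatrix_detForm`).

The reduction is a straightening. Cells sharing a row or column annihilate det, and the antidiagonal
of a 2 × 2 block can be traded for its diagonal up to sign, which raises the weight Σ row·column.
Koszul relations only redistribute cells and preserve the weight, so descending induction on the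
weight applies. Taking l + 1 close to n/2 gives the stated inequalities. -/

open MvPolynomial

/-! ### The apolar pairing and the Koszul flattening. -/

/-- The apolar pairing of polynomials: `f` acts on `P` as a differential operator, and the result
is evaluated at the origin. -/
noncomputable def apolar {σ : Type*} :
    MvPolynomial σ ℂ →ₗ[ℂ] MvPolynomial σ ℂ →ₗ[ℂ] ℂ :=
  (basisMonomials σ ℂ).constr ℂ fun s => ((s.prod fun _ k => k.factorial : ℕ) : ℂ) • lcoeff ℂ s

theorem apolar_monomial {σ : Type*} (s : σ →₀ ℕ) (P : MvPolynomial σ ℂ) :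
    apolar (monomial s 1) P = ((s.prod fun _ k => k.factorial : ℕ) : ℂ) * coeff s P := by
  have h := (basisMonomials σ ℂ).constr_basis ℂ
    (fun s => ((s.prod fun _ k => k.factorial : ℕ) : ℂ) • lcoeff ℂ s) s
  rw [coe_basisMonomials] at h
  rw [apolar, h]
  simp [lcoeff_apply]

/-- Each monomial contributes its multinomial coefficient times the product of the factorials of its
exponents, which is always n!. -/
theorem apolar_linearForm_pow {σ : Type*} [Fintype σ] (a : σ → ℂ) {n : ℕ}
    {f : MvPolynomial σ ℂ} (hf : f.IsHomogeneous n) :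
    apolar f ((∑ i, a i • X i) ^ n) = (n.factorial : ℂ) * eval a f := by
  rw [f.as_sum, map_sum, map_sum, LinearMap.sum_apply, Finset.mul_sum]
  refine Finset.sum_congr rfl fun s hs => ?_
  have hdeg : s.sum (fun _ m => m) = n := by
    have := hf (mem_support_iff.1 hs)
    rwa [Finsupp.weight_apply, show (s.sum fun i c => c • (1 : σ → ℕ) i) = s.sum fun _ m => m by
      simp] at this
  have hmon : monomial s (coeff s f) = coeff s f • monomial s (1 : ℂ) := by simp [smul_monomial]
  rw [hmon, map_smul, LinearMap.smul_apply, apolar_monomial,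
    coeff_linearCombination_X_pow_of_fintype, if_pos hdeg, smul_eq_mul, ← hmon, eval_monomial]
  have hmul : (s.prod fun _ k => k.factorial) * s.multinomial = n.factorial := by
    rw [← hdeg]
    exact Nat.multinomial_spec s.support s
  rw [← hmul]
  push_cast
  ring

/-- The pairing of `e_a ∧ e_b` with `e_p ∧ e_q`. -/
def wedgePair {σ : Type*} [DecidableEq σ] (a b p q : σ) : ℂ :=
  (if a = p ∧ b = q then 1 else 0) - (if a = q ∧ b = p then 1 else 0)

theorem wedgePair_self {σ : Type*} [DecidableEq σ] (a p q : σ) : wedgePair a a p q = 0 := by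
  simp [wedgePair, and_comm]

theorem wedgePair_swap {σ : Type*} [DecidableEq σ] (a b p q : σ) :
    wedgePair a b p q = -wedgePair b a p q := by
  simp only [wedgePair, and_comm (a := a = q), and_comm (a := a = p)]
  ring

/-- The squarefree monomial with support `S`. -/
noncomputable def squarefree {σ : Type*} (S : Finset σ) : MvPolynomial σ ℂ := ∏ c ∈ S, X c

theorem squarefree_isHomogeneous {σ : Type*} (S : Finset σ) :
    (squarefree S).IsHomogeneous S.card := by
  simpa [squarefree] using IsHomogeneous.prod S (fun c => (X c : MvPolynomial σ ℂ)) (fun _ => 1)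
    (fun c _ => isHomogeneous_X ℂ c)

theorem squarefree_insert {σ : Type*} [DecidableEq σ] {S : Finset σ} {c : σ} (hc : c ∉ S) :
    squarefree (insert c S) = X c * squarefree S :=
  Finset.prod_insert hc

/-- The element `f(∂) P ⊗ e_a ∧ e_b`, as a vector of its pairings with the squarefree operators
of degree `k` and the bivectors `e_p ∧ e_q`. -/
noncomputable def bracket {σ : Type*} [DecidableEq σ] (k : ℕ) (P f : MvPolynomial σ ℂ) (a b : σ) :
    {B : Finset σ // B.card = k} × σ × σ → ℂ :=
  fun y => apolar (squarefree y.1.1 * f) P * wedgePair a b y.2.1 y.2.2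

/-- The image of `f(∂) P ⊗ e_a ∧ e_b ∧ e_c` under the Koszul differential. -/
noncomputable def koszulRow {σ : Type*} [DecidableEq σ] (k : ℕ) (P f : MvPolynomial σ ℂ)
    (a b c : σ) : {B : Finset σ // B.card = k} × σ × σ → ℂ :=
  bracket k P (X a * f) b c - bracket k P (X b * f) a c + bracket k P (X c * f) a b

/-- The matrix of the Koszul flattening of `P`, restricted to squarefree operators. -/
noncomputable def koszulMatrix {σ : Type*} [DecidableEq σ] (k l : ℕ) (P : MvPolynomial σ ℂ) :
    Matrix ({D : Finset σ // D.card = l} × σ × σ × σ) ({B : Finset σ // B.card = k} × σ × σ) ℂ :=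
  fun x => koszulRow k P (squarefree x.1.1) x.2.1 x.2.2.1 x.2.2.2

theorem koszulMatrix_add {σ : Type*} [DecidableEq σ] (k l : ℕ) (P Q : MvPolynomial σ ℂ) :
    koszulMatrix k l (P + Q) = koszulMatrix k l P + koszulMatrix k l Q := by
  ext x y
  simp only [koszulMatrix, koszulRow, bracket, Matrix.add_apply, Pi.add_apply, Pi.sub_apply,
    map_add]
  ring

theorem koszulMatrix_smul {σ : Type*} [DecidableEq σ] (k l : ℕ) (c : ℂ) (P : MvPolynomial σ ℂ) :
    koszulMatrix k l (c • P) = c • koszulMatrix k l P := by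
  ext x y
  simp only [koszulMatrix, koszulRow, bracket, Matrix.smul_apply, Pi.add_apply, Pi.sub_apply,
    map_smul, smul_eq_mul]
  ring

/-- The Koszul flattening matrix as a linear function of the form. -/
noncomputable def koszulMatrixLinear (σ : Type*) [DecidableEq σ] (k l : ℕ) :
    MvPolynomial σ ℂ →ₗ[ℂ]
      Matrix ({D : Finset σ // D.card = l} × σ × σ × σ) ({B : Finset σ // B.card = k} × σ × σ) ℂ where
  toFun := koszulMatrix k l
  map_add' := koszulMatrix_add k l
  map_smul' := koszulMatrix_smul k l

/-! ### The flattening of a power of a linear form. -/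

/-- Contraction of `e_a ∧ e_b ∧ e_c` with `v`. -/
def contraction {σ : Type*} [DecidableEq σ] (v : σ → ℂ) (a b c : σ) : σ × σ → ℂ :=
  fun y => v a * wedgePair b c y.1 y.2 - v b * wedgePair a c y.1 y.2 + v c * wedgePair a b y.1 y.2

theorem exists_pair_of_card_two {σ : Type*} [DecidableEq σ] :
    ∃ f g : {t : Finset σ // t.card = 2} → σ, ∀ t, f t ≠ g t ∧ t.1 = {f t, g t} := by
  have h : ∀ t : {t : Finset σ // t.card = 2}, ∃ x y, x ≠ y ∧ t.1 = {x, y} :=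
    fun t => Finset.card_eq_two.1 t.2
  choose f g h using h
  exact ⟨f, g, h⟩

/-- Contracting o∧a∧b∧c twice with v gives zero; since v o ≠ 0, this identity can be solved for the
contraction of a∧b∧c in terms of trivectors containing o. -/
theorem contraction_mem_span {σ : Type*} [DecidableEq σ] (v : σ → ℂ) (o : σ) (ho : v o ≠ 0)
    {f g : {t : Finset σ // t.card = 2} → σ} (hfg : ∀ t, f t ≠ g t ∧ t.1 = {f t, g t})
    (a b c : σ) :
    contraction v a b c ∈ Submodule.span ℂ (Set.range
      fun t : {t : {t : Finset σ // t.card = 2} // o ∉ t.1} =>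
        contraction v o (f t.1) (g t.1)) := by
  set Z := Submodule.span ℂ (Set.range
      fun t : {t : {t : Finset σ // t.card = 2} // o ∉ t.1} =>
        contraction v o (f t.1) (g t.1)) with hZ
  have hself : ∀ p : σ, contraction v o p p = 0 := by
    intro p
    ext y
    simp only [contraction, wedgePair_self, Pi.zero_apply]
    ring
  have hswap : ∀ p q : σ, contraction v o p q = -contraction v o q p := by
    intro p q
    ext y
    simp only [contraction, Pi.neg_apply]
    rw [wedgePair_swap p q]
    ring
  have hleft : ∀ q : σ, contraction v o o q = 0 := by
    intro q
    ext y
    simp only [contraction, wedgePair_self, Pi.zero_apply]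
    ring
  have key : ∀ p q : σ, contraction v o p q ∈ Z := by
    intro p q
    by_cases hp : p = o
    · rw [hp, hleft]; exact Z.zero_mem
    by_cases hq : q = o
    · rw [hq, hswap, hleft, neg_zero]; exact Z.zero_mem
    by_cases hpq : p = q
    · rw [hpq, hself]; exact Z.zero_mem
    let t : {t : Finset σ // t.card = 2} := ⟨{p, q}, Finset.card_pair hpq⟩
    have ht : contraction v o (f t) (g t) ∈ Z :=
      Submodule.subset_span ⟨⟨t, by simp [t, Ne.symm hp, Ne.symm hq]⟩, rfl⟩
    obtain ⟨hne, heq⟩ := hfg t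
    have hf : f t ∈ ({p, q} : Finset σ) := by
      change f t ∈ t.1
      rw [heq]; simp
    have hg : g t ∈ ({p, q} : Finset σ) := by
      change g t ∈ t.1
      rw [heq]; simp
    simp only [Finset.mem_insert, Finset.mem_singleton] at hf hg
    rcases hf with hf | hf <;> rcases hg with hg | hg
    · exact absurd (hf.trans hg.symm) hne
    · rwa [hf, hg] at ht
    · rw [hf, hg] at ht
      rw [hswap]
      exact Z.neg_mem ht
    · exact absurd (hf.trans hg.symm) hne
  have : contraction v a b c = (v o)⁻¹ • (v a • contraction v o b c - v b • contraction v o a c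
      + v c • contraction v o a b) := by
    rw [eq_inv_smul_iff₀ ho]
    ext y
    simp only [contraction, Pi.smul_apply, Pi.add_apply, Pi.sub_apply, smul_eq_mul]
    ring
  rw [this]
  exact Z.smul_mem _ (Z.add_mem (Z.sub_mem (Z.smul_mem _ (key _ _)) (Z.smul_mem _ (key _ _)))
    (Z.smul_mem _ (key _ _)))

theorem card_pairs_avoiding {σ : Type*} [Fintype σ] [DecidableEq σ] (o : σ) :
    Fintype.card {t : {t : Finset σ // t.card = 2} // o ∉ t.1} =
      (Fintype.card σ - 1).choose 2 := by
  rw [← Finset.card_univ (α := σ), ← Finset.card_erase_of_mem (Finset.mem_univ o),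
    ← Finset.card_powersetCard, ← Fintype.card_coe]
  refine Fintype.card_congr ⟨fun t => ⟨t.1.1, ?_⟩, fun t => ⟨⟨t.1, ?_⟩, ?_⟩, fun _ => rfl,
    fun _ => rfl⟩
  · rw [Finset.mem_powersetCard]
    exact ⟨fun x hx => Finset.mem_erase.2 ⟨fun h => t.2 (h ▸ hx), Finset.mem_univ _⟩, t.1.2⟩
  · exact (Finset.mem_powersetCard.1 t.2).2
  · exact fun ho => (Finset.mem_erase.1 ((Finset.mem_powersetCard.1 t.2).1 ho)).1 rfl

theorem finrank_span_contraction_le {σ : Type*} [Fintype σ] [DecidableEq σ] (v : σ → ℂ) :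
    Module.finrank ℂ (Submodule.span ℂ (Set.range fun x : σ × σ × σ =>
      contraction v x.1 x.2.1 x.2.2)) ≤ (Fintype.card σ - 1).choose 2 := by
  by_cases hv : ∃ o, v o ≠ 0
  · obtain ⟨o, ho⟩ := hv
    obtain ⟨f, g, hfg⟩ := exists_pair_of_card_two (σ := σ)
    have hle := Submodule.finrank_mono (Submodule.span_le.2 (Set.range_subset_iff.2
      fun x : σ × σ × σ => contraction_mem_span v o ho hfg x.1 x.2.1 x.2.2))
    exact hle.trans ((finrank_range_le_card _).trans (card_pairs_avoiding o).le)
  · push Not at hv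
    have : Submodule.span ℂ (Set.range fun x : σ × σ × σ =>
        contraction v x.1 x.2.1 x.2.2) = ⊥ := by
      rw [Submodule.span_eq_bot]
      rintro _ ⟨x, rfl⟩
      ext y
      simp [contraction, hv]
    rw [this]
    simp

/-- Derivatives of vⁿ are multiples of powers of v, so each entry splits into a scalar depending on
the row, a factor depending on the operator B, and a contraction. All rows therefore lie in the
image of the contractions under one linear map. -/
theorem koszulMatrix_linearForm_pow {σ : Type*} [Fintype σ] [DecidableEq σ] (v : σ → ℂ)
    {n k l : ℕ} (h : k + (1 + l) = n) (x : {D : Finset σ // D.card = l} × σ × σ × σ)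
    (y : {B : Finset σ // B.card = k} × σ × σ) :
    koszulMatrix k l ((∑ i, v i • X i) ^ n) x y =
      ((n.factorial : ℂ) * eval v (squarefree x.1.1)) * (eval v (squarefree y.1.1) *
        contraction v x.2.1 x.2.2.1 x.2.2.2 y.2) := by
  have hom : ∀ a : σ, (squarefree y.1.1 * (X a * squarefree x.1.1) :
      MvPolynomial σ ℂ).IsHomogeneous n := by
    intro a
    have h1 := (squarefree_isHomogeneous y.1.1).mul
      ((isHomogeneous_X ℂ a).mul (squarefree_isHomogeneous x.1.1))
    rwa [x.1.2, y.1.2, h] at h1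
  simp only [koszulMatrix, koszulRow, bracket, Pi.add_apply, Pi.sub_apply,
    apolar_linearForm_pow v (hom _), map_mul, eval_X, contraction]
  ring

theorem rank_koszulMatrix_linearForm_pow_le {σ : Type*} [Fintype σ] [DecidableEq σ] (v : σ → ℂ)
    {n k l : ℕ} (h : k + (1 + l) = n) :
    (koszulMatrix k l ((∑ i, v i • X i) ^ n)).rank ≤ (Fintype.card σ - 1).choose 2 := by
  rw [Matrix.rank_eq_finrank_span_row]
  let T : (σ × σ → ℂ) →ₗ[ℂ] ({B : Finset σ // B.card = k} × σ × σ → ℂ) :=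
    { toFun := fun g y => eval v (squarefree y.1.1) * g y.2
      map_add' := fun g g' => by ext y; simp [mul_add]
      map_smul' := fun c g => by ext y; simp; ring }
  refine le_trans (Submodule.finrank_mono (t := (Submodule.span ℂ (Set.range
    fun x : σ × σ × σ => contraction v x.1 x.2.1 x.2.2)).map T) ?_)
    ((Submodule.finrank_map_le T _).trans (finrank_span_contraction_le v))
  rw [Submodule.span_le]
  rintro _ ⟨x, rfl⟩
  have : (koszulMatrix k l ((∑ i, v i • X i) ^ n)).row x =
      ((n.factorial : ℂ) * eval v (squarefree x.1.1)) •
        T (contraction v x.2.1 x.2.2.1 x.2.2.2) := by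
    ext y
    exact koszulMatrix_linearForm_pow v h x y
  rw [this]
  exact Submodule.smul_mem _ _ (Submodule.mem_map_of_mem (Submodule.subset_span ⟨x.2, rfl⟩))

/-! ### From symmetric rank to symmetric border rank. -/

theorem Matrix.rank_add_le_rank_add_rank {K ι κ : Type*} [Field K] [Fintype ι] [Fintype κ]
    (A B : Matrix ι κ K) : (A + B).rank ≤ A.rank + B.rank := by
  have hle : LinearMap.range (A + B).mulVecLin ≤
      LinearMap.range A.mulVecLin ⊔ LinearMap.range B.mulVecLin := by
    rw [Matrix.mulVecLin_add]
    rintro _ ⟨x, rfl⟩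
    exact Submodule.add_mem_sup ⟨x, rfl⟩ ⟨x, rfl⟩
  exact (Submodule.finrank_mono hle).trans (Submodule.finrank_add_le_finrank_add_finrank _ _)

theorem rank_koszulMatrix_le_of_sum {σ : Type*} [Fintype σ] [DecidableEq σ] {n k l : ℕ}
    (h : k + (1 + l) = n) {r : ℕ} (v : Fin r → SymPow σ 1) :
    (koszulMatrix k l (∑ i, (v i : MvPolynomial σ ℂ) ^ n)).rank ≤
      r * (Fintype.card σ - 1).choose 2 := by
  have hone : ∀ w : SymPow σ 1, (koszulMatrix k l ((w : MvPolynomial σ ℂ) ^ n)).rank ≤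
      (Fintype.card σ - 1).choose 2 := by
    rintro ⟨w, hw⟩
    rw [SymPow, homogeneousSubmodule_one_eq_span_X,
      Submodule.mem_span_range_iff_exists_fun] at hw
    obtain ⟨c, rfl⟩ := hw
    exact rank_koszulMatrix_linearForm_pow_le c h
  induction r with
  | zero =>
    have : koszulMatrix k l (0 : MvPolynomial σ ℂ) = 0 := (koszulMatrixLinear σ k l).map_zero
    simp [this]
  | succ r ih =>
    rw [Fin.sum_univ_succ, koszulMatrix_add]
    refine (Matrix.rank_add_le_rank_add_rank _ _).trans ?_
    have := ih fun i => v i.succ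
    have := hone (v 0)
    linarith

theorem Matrix.exists_mul_mul_eq_one {K ι κ : Type*} [Field K] [Fintype ι] [Fintype κ]
    (M : Matrix ι κ K) :
    ∃ (A : Matrix (Fin M.rank) ι K) (B : Matrix κ (Fin M.rank) K), A * M * B = 1 := by
  classical
  have hb := Module.finBasis K (LinearMap.range M.mulVecLin)
  let b : Module.Basis (Fin M.rank) K (LinearMap.range M.mulVecLin) := hb
  have hx : ∀ i, ∃ x, M.mulVecLin x = (b i : ι → K) := fun i => (b i).2
  choose x hx using hx
  let B : Matrix κ (Fin M.rank) K := Matrix.of fun j i => x i j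
  have hcol : ∀ i, (M * B).col i = (b i : ι → K) := by
    intro i
    rw [← hx i]
    rfl
  have hinj : Function.Injective (M * B).mulVec := by
    rw [Matrix.mulVec_injective_iff]
    have : (M * B).col = fun i => (b i : ι → K) := funext hcol
    rw [this]
    exact b.linearIndependent.map' (Submodule.subtype _) (Submodule.ker_subtype _)
  obtain ⟨g, hg⟩ := LinearMap.exists_leftInverse_of_injective (M * B).mulVecLin
    (LinearMap.ker_eq_bot.2 hinj)
  refine ⟨LinearMap.toMatrix' g, B, ?_⟩
  rw [Matrix.mul_assoc]
  have := congrArg LinearMap.toMatrix' hg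
  rwa [LinearMap.toMatrix'_comp, ← Matrix.toLin'_apply', LinearMap.toMatrix'_toLin',
    LinearMap.toMatrix'_id] at this

theorem polyFunctions_det_mem {W : Type*} [AddCommGroup W] [Module ℂ W] {r : ℕ}
    (φ : Fin r → Fin r → Module.Dual ℂ W) :
    (fun w => (Matrix.of fun i j => φ i j w).det) ∈ polyFunctions W := by
  have : (fun w => (Matrix.of fun i j => φ i j w).det) =
      ∑ τ : Equiv.Perm (Fin r), ((Equiv.Perm.sign τ : ℤ) : ℂ) •
        ∏ i, (φ (τ i) i : W → ℂ) := by
    ext w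
    simp [Matrix.det_apply', Finset.sum_apply, Finset.prod_apply]
  rw [this]
  refine Subalgebra.sum_mem _ fun τ _ => Subalgebra.smul_mem _ (Subalgebra.prod_mem _ fun i _ => ?_) _
  exact Algebra.subset_adjoin ⟨φ (τ i) i, rfl⟩

/-- If the rank at w exceeded r, matrices A and B with A (Φ w) B = 1 would make det(A Φ(·) B) a
polynomial function that vanishes on S and equals 1 at w. -/
theorem rank_le_of_mem_zariskiClosure {W ι κ : Type*} [AddCommGroup W] [Module ℂ W] [Fintype ι]
    [Fintype κ] (Φ : W →ₗ[ℂ] Matrix ι κ ℂ) {S : Set W} {r : ℕ} (hS : ∀ s ∈ S, (Φ s).rank ≤ r)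
    {w : W} (hw : w ∈ zariskiClosure S) : (Φ w).rank ≤ r := by
  by_contra! hlt
  obtain ⟨A, B, hAB⟩ := (Φ w).exists_mul_mul_eq_one
  let Ψ : W →ₗ[ℂ] Matrix (Fin (Φ w).rank) (Fin (Φ w).rank) ℂ :=
    { toFun := fun s => A * Φ s * B
      map_add' := fun s t => by rw [map_add, Matrix.mul_add, Matrix.add_mul]
      map_smul' := fun c s => by
        rw [map_smul, Matrix.mul_smul, Matrix.smul_mul, RingHom.id_apply] }
  have hF := polyFunctions_det_mem
    (fun i j => (Matrix.entryLinearMap ℂ ℂ i j : Matrix _ _ ℂ →ₗ[ℂ] ℂ) ∘ₗ Ψ)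
  have := hw _ hF ?_
  · have h1 : (Matrix.of fun i j => ((Matrix.entryLinearMap ℂ ℂ i j : Matrix _ _ ℂ →ₗ[ℂ] ℂ) ∘ₗ Ψ) w)
      = A * Φ w * B := rfl
    rw [h1, hAB, Matrix.det_one] at this
    exact one_ne_zero this
  · intro s hs
    by_contra hne
    have h1 : (Matrix.of fun i j => ((Matrix.entryLinearMap ℂ ℂ i j : Matrix _ _ ℂ →ₗ[ℂ] ℂ) ∘ₗ Ψ) s)
      = A * Φ s * B := rfl
    simp only [h1] at hne
    have h2 := Matrix.rank_of_det_ne_zero hne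
    have h3 := ((A * Φ s).rank_mul_le_left B).trans (A.rank_mul_le_right (Φ s))
    rw [h2, Fintype.card_fin] at h3
    exact absurd (h3.trans (hS s hs)) (not_le.2 hlt)

theorem exists_sum_pow_of_symmetricRank_eq {σ : Type*} {d r : ℕ} {T : SymPow σ d}
    (h : symmetricRank T = r) :
    ∃ v : Fin r → SymPow σ 1, (T : MvPolynomial σ ℂ) = ∑ i, (v i : MvPolynomial σ ℂ) ^ d := by
  unfold symmetricRank at h
  have hne : ((fun r : ℕ => (r : ℕ∞)) '' {r : ℕ | ∃ v : Fin r → SymPow σ 1,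
      (T : MvPolynomial σ ℂ) = ∑ i, (v i : MvPolynomial σ ℂ) ^ d}).Nonempty := by
    by_contra hem
    rw [Set.not_nonempty_iff_eq_empty.1 hem, sInf_empty] at h
    exact ENat.natCast_ne_top r h.symm
  have := csInf_mem hne
  rw [h] at this
  obtain ⟨r', hr', heq⟩ := this
  have : r' = r := Nat.cast_injective (R := ℕ∞) heq
  rwa [← this]

theorem rank_koszulMatrix_le_of_symmetricBorderRank_eq {σ : Type*} [Fintype σ] [DecidableEq σ]
    {n k l : ℕ} (h : k + (1 + l) = n) {P : SymPow σ n} {r : ℕ}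
    (hr : symmetricBorderRank P = r) :
    (koszulMatrix k l (P : MvPolynomial σ ℂ)).rank ≤ r * (Fintype.card σ - 1).choose 2 := by
  have hmem : P ∈ zariskiClosure {T : SymPow σ n | symmetricRank T = (r : ℕ∞)} := by
    unfold symmetricBorderRank at hr
    have hne : ((fun r : ℕ => (r : ℕ∞)) ''
        {r : ℕ | P ∈ zariskiClosure {T : SymPow σ n | symmetricRank T = (r : ℕ∞)}}).Nonempty := by
      by_contra hem
      rw [Set.not_nonempty_iff_eq_empty.1 hem, sInf_empty] at hr
      exact ENat.natCast_ne_top r hr.symm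
    have := csInf_mem hne
    rw [hr] at this
    obtain ⟨r', hr', heq⟩ := this
    have : r' = r := Nat.cast_injective (R := ℕ∞) heq
    rwa [← this]
  refine rank_le_of_mem_zariskiClosure
    ((koszulMatrixLinear σ k l) ∘ₗ (SymPow σ n).subtype) ?_ hmem
  intro T hT
  obtain ⟨v, hv⟩ := exists_sum_pow_of_symmetricRank_eq hT
  change (koszulMatrix k l (T : MvPolynomial σ ℂ)).rank ≤ _
  rw [hv]
  exact rank_koszulMatrix_le_of_sum h v

theorem exists_symmetricBorderRank_eq {σ : Type*} {n : ℕ} {P : SymPow σ n} {r : ℕ}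
    (v : Fin r → SymPow σ 1) (hv : (P : MvPolynomial σ ℂ) = ∑ i, (v i : MvPolynomial σ ℂ) ^ n) :
    ∃ r : ℕ, symmetricBorderRank P = r := by
  have hrank : symmetricRank P ≠ ⊤ := by
    refine ne_top_of_le_ne_top (ENat.natCast_ne_top r) (sInf_le ⟨r, ⟨v, hv⟩, rfl⟩)
  obtain ⟨s, hs⟩ := ENat.ne_top_iff_exists.1 hrank
  have : symmetricBorderRank P ≠ ⊤ := by
    refine ne_top_of_le_ne_top (ENat.natCast_ne_top s) (sInf_le ⟨s, ?_, rfl⟩)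
    exact fun F _ hF => hF P hs.symm
  obtain ⟨t, ht⟩ := ENat.ne_top_iff_exists.1 this
  exact ⟨t, ht.symm⟩

/-! ### Finiteness: the determinant is a sum of powers of linear forms. -/

/-- Toggling an element outside T pairs the supersets of T with opposite signs. -/
theorem sum_supersets_neg_one_pow_card {ι : Type*} [Fintype ι] [DecidableEq ι] {T : Finset ι}
    (hT : T ≠ Finset.univ) :
    ∑ S : Finset ι, (if T ⊆ S then (-1 : ℤ) ^ S.card else 0) = 0 := by
  obtain ⟨i, hi⟩ : ∃ i, i ∉ T := by
    by_contra! h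
    exact hT (Finset.eq_univ_iff_forall.2 h)
  refine Finset.sum_involution (fun S _ => if i ∈ S then S.erase i else insert i S) ?_ ?_ ?_ ?_
  · intro S _
    by_cases hS : i ∈ S
    · have hsub : T ⊆ S.erase i ↔ T ⊆ S :=
        ⟨fun h => h.trans (Finset.erase_subset _ _), fun h x hx =>
          Finset.mem_erase.2 ⟨fun e => hi (e ▸ hx), h hx⟩⟩
      simp only [if_pos hS, hsub]
      split_ifs
      · rw [← Finset.card_erase_add_one hS, pow_succ]
        ring
      · ring
    · have hsub : T ⊆ insert i S ↔ T ⊆ S := Finset.subset_insert_iff_of_notMem hi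
      simp only [if_neg hS, hsub]
      split_ifs
      · rw [Finset.card_insert_of_notMem hS, pow_succ]
        ring
      · ring
  · intro S _ _ h
    by_cases hS : i ∈ S
    · rw [if_pos hS] at h
      exact Finset.erase_ne_self.2 hS h
    · rw [if_neg hS] at h
      exact hS (Finset.insert_eq_self.1 h)
  · exact fun _ _ => Finset.mem_univ _
  · intro S _
    by_cases hS : i ∈ S
    · simp [hS]
    · simp [hS]

/-- The polarization identity for the product of the entries of a vector. -/
theorem sum_finset_neg_one_pow_mul_sum_pow {ι A : Type*} [Fintype ι] [DecidableEq ι] [CommRing A]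
    (x : ι → A) :
    ∑ S : Finset ι, (-1 : A) ^ S.card * (∑ i ∈ S, x i) ^ Fintype.card ι =
      (-1) ^ Fintype.card ι * ((Fintype.card ι).factorial * ∏ i, x i) := by
  -- The power expands over all maps f from ι to itself, and S contributes exactly those with image
  -- inside S. After the sums are interchanged, every non-surjective f cancels and the permutations
  -- remain.
  have hexp : ∀ S : Finset ι, (-1 : A) ^ S.card * (∑ i ∈ S, x i) ^ Fintype.card ι =
      ∑ f : ι → ι, (((if Finset.univ.image f ⊆ S then (-1 : ℤ) ^ S.card else 0 : ℤ)) : A) *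
        ∏ i, x (f i) := by
    intro S
    have : (∑ i ∈ S, x i) ^ Fintype.card ι =
        ∑ f ∈ Fintype.piFinset fun _ : ι => S, ∏ i, x (f i) := by
      rw [← Finset.prod_univ_sum]
      simp
    rw [this, Finset.mul_sum, ← Finset.sum_filter_add_sum_filter_not Finset.univ
      (fun f : ι → ι => f ∈ Fintype.piFinset fun _ : ι => S)]
    rw [Finset.sum_eq_zero (s := Finset.univ.filter fun f : ι → ι => ¬ _), add_zero]
    · refine Finset.sum_congr (by ext; simp) fun f hf => ?_
      rw [if_pos]
      · push_cast; rfl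
      · rw [Finset.image_subset_iff]
        exact fun i _ => Fintype.mem_piFinset.1 (by simpa using hf) i
    · intro f hf
      rw [if_neg]
      · simp
      · intro h
        rw [Finset.image_subset_iff] at h
        exact (Finset.mem_filter.1 hf).2 (Fintype.mem_piFinset.2 fun i => h i (Finset.mem_univ i))
  simp_rw [hexp]
  rw [Finset.sum_comm]
  simp_rw [← Finset.sum_mul, ← Int.cast_sum]
  have hperm : ∑ e : Equiv.Perm ι, (-1 : A) ^ Fintype.card ι * ∏ i, x (e i) =
      (-1) ^ Fintype.card ι * ((Fintype.card ι).factorial * ∏ i, x i) := by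
    simp_rw [Equiv.prod_comp]
    rw [Finset.sum_const, Finset.card_univ, Fintype.card_perm, nsmul_eq_mul]
    ring
  rw [← hperm]
  symm
  refine Finset.sum_of_injOn (fun e : Equiv.Perm ι => (e : ι → ι))
    (fun _ _ _ _ h => DFunLike.coe_injective h) (fun _ _ => Finset.mem_coe.2 (Finset.mem_univ _))
    ?_ ?_
  · intro f _ hf
    rw [sum_supersets_neg_one_pow_card, Int.cast_zero, zero_mul]
    intro h
    have hsurj : Function.Surjective f := fun y => by
      have : y ∈ Finset.univ.image f := by rw [h]; exact Finset.mem_univ y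
      simpa using this
    exact hf ⟨Equiv.ofBijective f (Finite.surjective_iff_bijective.1 hsurj), by simp, rfl⟩
  · intro e _
    have himg : Finset.univ.image (e : ι → ι) = Finset.univ :=
      Finset.image_univ_of_surjective e.surjective
    rw [himg, Finset.sum_eq_single Finset.univ]
    · simp
    · intro S _ hS
      rw [if_neg]
      exact fun h => hS (Finset.univ_subset_iff.1 h)
    · simp

/-- Over ℂ the coefficients are absorbed into the linear forms by n-th roots. -/
theorem exists_sum_pow_of_sum_smul {σ ι : Type*} [Fintype ι] {n : ℕ} (hn : n ≠ 0) (c : ι → ℂ)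
    (w : ι → SymPow σ 1) :
    ∃ (r : ℕ) (v : Fin r → SymPow σ 1),
      ∑ i, c i • (w i : MvPolynomial σ ℂ) ^ n = ∑ i, (v i : MvPolynomial σ ℂ) ^ n := by
  have hroot : ∀ i, ∃ z : ℂ, z ^ n = c i := fun i =>
    IsAlgClosed.exists_pow_nat_eq (c i) (Nat.pos_of_ne_zero hn)
  choose z hz using hroot
  let e := Fintype.equivFin ι
  refine ⟨Fintype.card ι, fun i => z (e.symm i) • w (e.symm i), ?_⟩
  rw [← e.symm.sum_comp]
  refine Finset.sum_congr rfl fun i _ => ?_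
  rw [Submodule.coe_smul, smul_pow, hz]

theorem exists_symmetricBorderRank_detForm_eq {n : ℕ} (hn : n ≠ 0) :
    ∃ r : ℕ, symmetricBorderRank (detForm n) = r := by
  let w : Equiv.Perm (Fin n) × Finset (Fin n) → SymPow (Fin n × Fin n) 1 := fun x =>
    ∑ i ∈ x.2, ⟨X (x.1 i, i), isHomogeneous_X ℂ _⟩
  -- Each of the n! terms of the determinant is polarized separately; the factor (−1)ⁿ/n! inverts
  -- the constant in the polarization identity.
  let c : Equiv.Perm (Fin n) × Finset (Fin n) → ℂ := fun x =>
    ((Equiv.Perm.sign x.1 : ℤ) : ℂ) * ((-1) ^ n * (n.factorial : ℂ)⁻¹ * (-1) ^ x.2.card)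
  obtain ⟨r, v, hv⟩ := exists_sum_pow_of_sum_smul hn c w
  refine exists_symmetricBorderRank_eq v (hv ▸ ?_)
  change (Matrix.mvPolynomialX (Fin n) (Fin n) ℂ).det = _
  rw [Matrix.det_apply', Fintype.sum_prod_type]
  refine Finset.sum_congr rfl fun τ _ => ?_
  have h := sum_finset_neg_one_pow_mul_sum_pow
    (fun i : Fin n => (X (τ i, i) : MvPolynomial (Fin n × Fin n) ℂ))
  rw [Fintype.card_fin] at h
  have hfac : (n.factorial : ℂ) ≠ 0 := Nat.cast_ne_zero.2 n.factorial_ne_zero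
  have hw : ∀ S, c (τ, S) • (w (τ, S) : MvPolynomial (Fin n × Fin n) ℂ) ^ n =
      C (((Equiv.Perm.sign τ : ℤ) : ℂ) * ((-1) ^ n * (n.factorial : ℂ)⁻¹)) *
        ((-1) ^ S.card * (∑ i ∈ S, (X (τ i, i) : MvPolynomial (Fin n × Fin n) ℂ)) ^ n) := by
    intro S
    simp only [c, w, Submodule.coe_sum, smul_eq_C_mul, map_mul, map_pow, map_neg, map_one]
    ring
  simp_rw [hw]
  rw [← Finset.mul_sum, h]
  have h1 : ((n.factorial : ℕ) : MvPolynomial (Fin n × Fin n) ℂ) = C (n.factorial : ℂ) := by simp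
  have h2 : (-1 : MvPolynomial (Fin n × Fin n) ℂ) ^ n = C ((-1) ^ n) := by simp
  rw [h1, h2, ← mul_assoc, ← mul_assoc, ← map_mul, ← map_mul]
  have h3 : ((Equiv.Perm.sign τ : ℤ) : ℂ) * ((-1) ^ n * (n.factorial : ℂ)⁻¹) * (-1) ^ n *
      (n.factorial : ℂ) = ((Equiv.Perm.sign τ : ℤ) : ℂ) := by
    have h4 : ((-1 : ℂ) ^ n) * (-1) ^ n = 1 := by rw [← mul_pow]; simp
    have h5 : (n.factorial : ℂ)⁻¹ * n.factorial = 1 := inv_mul_cancel₀ hfac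
    linear_combination ((Equiv.Perm.sign τ : ℤ) : ℂ) * (n.factorial : ℂ)⁻¹ * n.factorial * h4 +
      ((Equiv.Perm.sign τ : ℤ) : ℂ) * h5
  rw [h3]
  simp [Matrix.mvPolynomialX_apply]

/-! ### Apolar relations of the determinant. -/

/-- The exponent of the monomial of the determinant that belongs to the permutation `τ`. -/
noncomputable def permExponent {n : ℕ} (τ : Equiv.Perm (Fin n)) : Fin n × Fin n →₀ ℕ :=
  Finsupp.indicator (Finset.univ.image fun j => (τ j, j)) fun _ _ => 1

theorem permExponent_apply {n : ℕ} (τ : Equiv.Perm (Fin n)) (c : Fin n × Fin n) :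
    permExponent τ c = if τ c.2 = c.1 then 1 else 0 := by
  rw [permExponent, Finsupp.indicator_apply]
  have : c ∈ (Finset.univ.image fun j => (τ j, j)) ↔ τ c.2 = c.1 := by
    rw [Finset.mem_image]
    constructor
    · rintro ⟨j, _, rfl⟩; rfl
    · exact fun h => ⟨c.2, Finset.mem_univ _, Prod.ext h rfl⟩
  simp [this]

theorem permExponent_injective {n : ℕ} :
    Function.Injective (permExponent : Equiv.Perm (Fin n) → _) := by
  intro τ ρ h
  ext j : 1
  have := congrArg (fun s => s (τ j, j)) h
  simp only [permExponent_apply, if_true] at this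
  by_contra hne
  rw [if_neg (Ne.symm hne)] at this
  exact one_ne_zero this

theorem det_eq_sum_monomial (n : ℕ) :
    (detForm n : MvPolynomial (Fin n × Fin n) ℂ) =
      ∑ τ : Equiv.Perm (Fin n), ((Equiv.Perm.sign τ : ℤ) : ℂ) • monomial (permExponent τ) 1 := by
  change (Matrix.mvPolynomialX (Fin n) (Fin n) ℂ).det = _
  rw [Matrix.det_apply']
  refine Finset.sum_congr rfl fun τ _ => ?_
  have hprod : (∏ j, (X (τ j, j) : MvPolynomial (Fin n × Fin n) ℂ)) =
      monomial (permExponent τ) 1 := by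
    have hs : permExponent τ = ∑ j, Finsupp.single (τ j, j) 1 := by
      ext c
      rw [permExponent_apply, Finsupp.finsetSum_apply]
      simp only [Finsupp.single_apply]
      rw [Finset.sum_eq_single c.2]
      · by_cases h : τ c.2 = c.1 <;> simp [Prod.ext_iff, h]
      · intro j _ hj
        rw [if_neg]
        exact fun h => hj (congrArg Prod.snd h)
      · simp
    rw [hs, monomial_sum_one]
    rfl
  simp only [Matrix.mvPolynomialX_apply]
  rw [hprod, smul_eq_C_mul]
  simp

theorem apolar_detForm {n : ℕ} (f : MvPolynomial (Fin n × Fin n) ℂ) :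
    apolar f (detForm n) =
      ∑ τ : Equiv.Perm (Fin n), ((Equiv.Perm.sign τ : ℤ) : ℂ) * coeff (permExponent τ) f := by
  have hlin : (apolar.flip (detForm n : MvPolynomial (Fin n × Fin n) ℂ)) =
      ∑ τ : Equiv.Perm (Fin n), ((Equiv.Perm.sign τ : ℤ) : ℂ) • lcoeff ℂ (permExponent τ) := by
    refine (basisMonomials (Fin n × Fin n) ℂ).ext fun s => ?_
    rw [coe_basisMonomials, LinearMap.flip_apply, apolar_monomial, det_eq_sum_monomial, coeff_sum,
      Finset.mul_sum, LinearMap.sum_apply]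
    refine Finset.sum_congr rfl fun τ _ => ?_
    rw [LinearMap.smul_apply, lcoeff_apply, coeff_smul, coeff_monomial, coeff_monomial]
    by_cases h : permExponent τ = s
    · have hfac : (s.prod fun _ k => k.factorial) = 1 := by
        refine Finset.prod_eq_one fun c _ => ?_
        simp only [← h, permExponent_apply]
        split_ifs <;> rfl
      rw [if_pos h, if_pos h.symm, hfac]
      simp
    · rw [if_neg h, if_neg (Ne.symm h)]
      simp
  have := congrArg (fun F => F f) hlin
  simpa [LinearMap.sum_apply, lcoeff_apply] using this

/-- No monomial of the determinant contains two cells of one row or column, or the square of a cell.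
-/
theorem apolar_detForm_mul_eq_zero {n : ℕ} {a b : Fin n × Fin n} (h : a.1 = b.1 ∨ a.2 = b.2)
    (g : MvPolynomial (Fin n × Fin n) ℂ) : apolar (X a * (X b * g)) (detForm n) = 0 := by
  rw [apolar_detForm]
  refine Finset.sum_eq_zero fun τ _ => ?_
  rw [coeff_X_mul', coeff_X_mul']
  simp only [Finsupp.mem_support_iff, Finsupp.coe_tsub, Pi.sub_apply, permExponent_apply,
    Finsupp.single_apply]
  by_cases ha : τ a.2 = a.1
  · by_cases hab : a = b
    · subst hab
      simp [ha]
    · by_cases hb : τ b.2 = b.1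
      · exfalso
        rcases h with h | h
        · exact hab (Prod.ext h (τ.injective (by rw [ha, hb, h])))
        · exact hab (Prod.ext (by rw [← ha, ← hb, h]) h)
      · simp [hb]
  · simp [ha]

/-- Composing τ with the transposition of the two columns matches the monomials on both sides and
changes the sign. -/
theorem apolar_detForm_exchange {n : ℕ} {a b : Fin n × Fin n} (h1 : a.1 ≠ b.1) (h2 : a.2 ≠ b.2)
    (g : MvPolynomial (Fin n × Fin n) ℂ) :
    apolar (X a * (X b * g)) (detForm n) =
      -apolar (X (a.1, b.2) * (X (b.1, a.2) * g)) (detForm n) := by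
  rw [apolar_detForm, apolar_detForm, ← Finset.sum_neg_distrib,
    ← Equiv.sum_comp (Equiv.mulRight (Equiv.swap a.2 b.2))]
  refine Finset.sum_congr rfl fun τ _ => ?_
  rw [Equiv.coe_mulRight, Equiv.Perm.sign_mul, Equiv.Perm.sign_swap h2]
  have hs : ∀ s : Fin n × Fin n →₀ ℕ, ∀ p q : Fin n × Fin n, p ≠ q →
      coeff s (X p * (X q * g)) = if s p ≠ 0 ∧ s q ≠ 0 then
        coeff (s - (Finsupp.single p 1 + Finsupp.single q 1)) g else 0 := by
    intro s p q hpq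
    rw [coeff_X_mul', coeff_X_mul']
    simp only [Finsupp.mem_support_iff, Finsupp.coe_tsub, Pi.sub_apply,
      Finsupp.single_eq_of_ne (Ne.symm hpq), Nat.sub_zero, tsub_tsub]
    by_cases hp : s p = 0 <;> by_cases hq : s q = 0 <;> simp [hp, hq]
  rw [hs _ a b (fun h => h1 (congrArg Prod.fst h)),
    hs _ (a.1, b.2) (b.1, a.2) (fun h => h1 (Prod.ext_iff.1 h).1)]
  simp only [permExponent_apply, Equiv.Perm.mul_apply, Equiv.swap_apply_left,
    Equiv.swap_apply_right]
  by_cases ha : τ b.2 = a.1 <;> by_cases hb : τ a.2 = b.1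
  · have hexp : permExponent (τ * Equiv.swap a.2 b.2) -
        (Finsupp.single a 1 + Finsupp.single b 1) = permExponent τ -
        (Finsupp.single (a.1, b.2) 1 + Finsupp.single (b.1, a.2) 1) := by
      ext c
      simp only [Finsupp.coe_tsub, Pi.sub_apply, Finsupp.coe_add, Pi.add_apply,
        permExponent_apply, Finsupp.single_apply, Equiv.Perm.mul_apply]
      obtain ⟨i, j⟩ := c
      obtain ⟨a1, a2⟩ := a
      obtain ⟨b1, b2⟩ := b
      simp only [Prod.mk.injEq] at *
      by_cases hj1 : j = a2
      · subst hj1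
        simp [ha, hb, Ne.symm h2]
      · by_cases hj2 : j = b2
        · subst hj2
          simp [ha, hb, h2]
        · simp [Equiv.swap_apply_of_ne_of_ne hj1 hj2, Ne.symm hj1, Ne.symm hj2]
    simp [ha, hb, hexp]
  · simp [hb]
  · simp [ha]
  · simp [ha]

theorem coeff_squarefree {σ : Type*} [DecidableEq σ] (S : Finset σ) (s : σ →₀ ℕ) :
    coeff s (squarefree S) = if s = Finsupp.indicator S (fun _ _ => 1) then 1 else 0 := by
  have := coeff_prod_X_pow (R := ℂ) s (fun _ => 1) S
  simpa [squarefree] using this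

theorem apolar_squarefree_detForm_ne_zero {n : ℕ} {S : Finset (Fin n × Fin n)}
    (τ : Equiv.Perm (Fin n)) (h : S = Finset.univ.image fun j => (τ j, j)) :
    apolar (squarefree S) (detForm n) ≠ 0 := by
  rw [apolar_detForm, Finset.sum_eq_single τ]
  · rw [coeff_squarefree, h, ← permExponent, if_pos rfl]
    rcases Int.units_eq_one_or (Equiv.Perm.sign τ) with h | h <;> simp [h]
  · intro ρ _ hρ
    rw [coeff_squarefree, if_neg, mul_zero]
    rw [h]
    exact fun e => hρ (permExponent_injective e)
  · simp

/-! ### Chains of cells and straightening of brackets. -/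

/-- `a` lies strictly to the upper left of `b`. -/
def Below {n : ℕ} (a b : Fin n × Fin n) : Prop := a.1 < b.1 ∧ a.2 < b.2

/-- Two cells are strictly comparable. -/
def Comparable {n : ℕ} (a b : Fin n × Fin n) : Prop := Below a b ∨ Below b a

theorem Comparable.symm {n : ℕ} {a b : Fin n × Fin n} (h : Comparable a b) : Comparable b a :=
  Or.symm h

theorem not_comparable_self {n : ℕ} (a : Fin n × Fin n) : ¬Comparable a a := by
  simp [Comparable, Below]

theorem Below.not_below {n : ℕ} {a b : Fin n × Fin n} (h : Below a b) : ¬Below b a :=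
  fun h' => lt_asymm h.1 h'.1

/-- A set of cells any two of which are strictly comparable. -/
def IsCellChain {n : ℕ} (S : Finset (Fin n × Fin n)) : Prop :=
  ∀ a ∈ S, ∀ b ∈ S, a ≠ b → Comparable a b

theorem IsCellChain.mono {n : ℕ} {S T : Finset (Fin n × Fin n)} (hT : IsCellChain T)
    (h : S ⊆ T) : IsCellChain S :=
  fun a ha b hb => hT a (h ha) b (h hb)

theorem IsCellChain.insert {n : ℕ} {S : Finset (Fin n × Fin n)} (hS : IsCellChain S)
    {a : Fin n × Fin n} (ha : ∀ d ∈ S, Comparable a d) : IsCellChain (insert a S) := by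
  intro p hp q hq hpq
  rcases Finset.mem_insert.1 hp with hpa | hpS <;> rcases Finset.mem_insert.1 hq with hqa | hqS
  · exact absurd (hpa.trans hqa.symm) hpq
  · exact hpa ▸ ha q hqS
  · exact hqa ▸ (ha p hpS).symm
  · exact hS p hpS q hqS hpq

theorem IsCellChain.exists_least {n : ℕ} {S : Finset (Fin n × Fin n)} (hS : IsCellChain S)
    (hne : S.Nonempty) : ∃ a ∈ S, ∀ e ∈ S, e ≠ a → Below a e := by
  obtain ⟨a, ha, hmin⟩ := S.exists_min_image Prod.fst hne
  refine ⟨a, ha, fun e he hea => ?_⟩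
  rcases hS a ha e he (Ne.symm hea) with h | h
  · exact h
  · exact absurd h.1 (not_lt.2 (hmin e he))

/-- `b` is not strictly comparable to some cell of `S`. -/
def Conflicts {n : ℕ} (b : Fin n × Fin n) (S : Finset (Fin n × Fin n)) : Prop :=
  ∃ d ∈ S, ¬Comparable b d

theorem Conflicts.mono {n : ℕ} {b : Fin n × Fin n} {S T : Finset (Fin n × Fin n)}
    (h : Conflicts b S) (hST : S ⊆ T) : Conflicts b T :=
  let ⟨d, hd, hbd⟩ := h
  ⟨d, hST hd, hbd⟩

theorem not_conflicts_iff {n : ℕ} {b : Fin n × Fin n} {S : Finset (Fin n × Fin n)} :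
    ¬Conflicts b S ↔ ∀ d ∈ S, Comparable b d := by
  simp [Conflicts]

/-- The weight that increases when a conflicting pair of cells is exchanged. -/
def cellWeight {n : ℕ} (c : Fin n × Fin n) : ℕ := c.1.1 * c.2.1

/-- The bracket of the determinant. -/
noncomputable abbrev detBracket (n k : ℕ) (f : MvPolynomial (Fin n × Fin n) ℂ)
    (a b : Fin n × Fin n) := bracket k (detForm n : MvPolynomial (Fin n × Fin n) ℂ) f a b

theorem detBracket_swap {n k : ℕ} (f : MvPolynomial (Fin n × Fin n) ℂ) (a b : Fin n × Fin n) :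
    detBracket n k f a b = -detBracket n k f b a := by
  ext y
  simp only [bracket, Pi.neg_apply]
  rw [wedgePair_swap a b]
  ring

theorem detBracket_eq_zero {n k : ℕ} {p q : Fin n × Fin n} (h : p.1 = q.1 ∨ p.2 = q.2)
    (g : MvPolynomial (Fin n × Fin n) ℂ) (a b : Fin n × Fin n) :
    detBracket n k (X p * (X q * g)) a b = 0 := by
  ext y
  simp only [bracket, Pi.zero_apply]
  rw [show squarefree y.1.1 * (X p * (X q * g)) = X p * (X q * (squarefree y.1.1 * g)) by ring,
    apolar_detForm_mul_eq_zero h, zero_mul]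

theorem detBracket_exchange {n k : ℕ} {p q : Fin n × Fin n} (h1 : p.1 ≠ q.1) (h2 : p.2 ≠ q.2)
    (g : MvPolynomial (Fin n × Fin n) ℂ) (a b : Fin n × Fin n) :
    detBracket n k (X p * (X q * g)) a b =
      -detBracket n k (X (p.1, q.2) * (X (q.1, p.2) * g)) a b := by
  ext y
  simp only [bracket, Pi.neg_apply]
  rw [show squarefree y.1.1 * (X p * (X q * g)) = X p * (X q * (squarefree y.1.1 * g)) by ring,
    apolar_detForm_exchange h1 h2, show squarefree y.1.1 * (X (p.1, q.2) * (X (q.1, p.2) * g)) =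
      X (p.1, q.2) * (X (q.1, p.2) * (squarefree y.1.1 * g)) by ring, neg_mul]

theorem X_mul_squarefree_erase {σ : Type*} [DecidableEq σ] {S : Finset σ} {c : σ} (hc : c ∈ S) :
    X c * squarefree (S.erase c) = squarefree S :=
  Finset.mul_prod_erase S _ hc

/-- Two incomparable cells p, q in distinct rows and columns satisfy (p₁ − q₁)(p₂ − q₂) < 0, so
exchanging their columns raises p₁p₂ + q₁q₂. -/
theorem detBracket_mem_of_not_chain {n k : ℕ}
    {Z : Submodule ℂ ({B : Finset (Fin n × Fin n) // B.card = k} × (Fin n × Fin n) ×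
      (Fin n × Fin n) → ℂ)} {S : Finset (Fin n × Fin n)} (hS : ¬IsCellChain S)
    {a b : Fin n × Fin n}
    (ih : ∀ S' : Finset (Fin n × Fin n), S'.card = S.card →
      ∑ c ∈ S, cellWeight c < ∑ c ∈ S', cellWeight c → detBracket n k (squarefree S') a b ∈ Z) :
    detBracket n k (squarefree S) a b ∈ Z := by
  simp only [IsCellChain] at hS
  push Not at hS
  obtain ⟨p, hp, q, hq, hpq, hcomp⟩ := hS
  set T := (S.erase p).erase q with hT
  have hq' : q ∈ S.erase p := Finset.mem_erase.2 ⟨Ne.symm hpq, hq⟩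
  have hsq : squarefree S = X p * (X q * squarefree T) := by
    rw [X_mul_squarefree_erase hq', X_mul_squarefree_erase hp]
  rw [hsq]
  by_cases h : p.1 = q.1 ∨ p.2 = q.2
  · rw [detBracket_eq_zero h]
    exact Z.zero_mem
  push Not at h
  obtain ⟨h1, h2⟩ := h
  rw [detBracket_exchange h1 h2]
  refine Z.neg_mem ?_
  -- A new cell already present in `T` would occur squared, which annihilates the determinant.
  by_cases hp' : (p.1, q.2) ∈ T
  · rw [← X_mul_squarefree_erase hp', mul_left_comm (X (q.1, p.2)),
      detBracket_eq_zero (Or.inl rfl)]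
    exact Z.zero_mem
  by_cases hq'' : (q.1, p.2) ∈ T
  · rw [← X_mul_squarefree_erase hq'', mul_left_comm (X (p.1, q.2)), mul_left_comm (X (p.1, q.2)),
      detBracket_eq_zero (Or.inl rfl)]
    exact Z.zero_mem
  have hp'' : (p.1, q.2) ∉ insert (q.1, p.2) T := by
    rw [Finset.mem_insert, not_or]
    exact ⟨fun e => h1 (Prod.ext_iff.1 e).1, hp'⟩
  rw [← squarefree_insert hq'', ← squarefree_insert hp'']
  have hcard : T.card + 2 = S.card := by
    rw [hT, ← Finset.card_erase_add_one hp, ← Finset.card_erase_add_one hq']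
  refine ih _ ?_ ?_
  · rw [Finset.card_insert_of_notMem hp'', Finset.card_insert_of_notMem hq'', ← hcard]
  · rw [Finset.sum_insert hp'', Finset.sum_insert hq'', ← Finset.add_sum_erase S _ hp,
      ← Finset.add_sum_erase _ _ hq', ← hT, ← add_assoc, ← add_assoc]
    refine Nat.add_lt_add_right ?_ _
    simp only [cellWeight]
    have h1' : p.1.1 ≠ q.1.1 := fun e => h1 (Fin.ext e)
    have h2' : p.2.1 ≠ q.2.1 := fun e => h2 (Fin.ext e)
    simp only [Comparable, Below, Fin.lt_def, not_or, not_and, not_lt] at hcomp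
    rcases lt_or_gt_of_ne h1' with hlt | hlt
    · have := lt_of_le_of_ne (hcomp.1 hlt) (Ne.symm h2')
      nlinarith
    · have := lt_of_le_of_ne (hcomp.2 hlt) h2'
      nlinarith

/-! ### Reduction to normal forms: `Z` contains the rows (`hrow`), the brackets of weight above `w`
(`ih`) and one bracket for each normal form (`hnf`). -/

section Reduction

variable {n k l : ℕ}
  {Z : Submodule ℂ ({B : Finset (Fin n × Fin n) // B.card = k} × (Fin n × Fin n) ×
      (Fin n × Fin n) → ℂ)}
  (hrow : ∀ D : Finset (Fin n × Fin n), D.card = l → ∀ a b c,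
    koszulRow k (detForm n : MvPolynomial (Fin n × Fin n) ℂ) (squarefree D) a b c ∈ Z)
  {w : ℕ}
  (ih : ∀ (S : Finset (Fin n × Fin n)) (a b : Fin n × Fin n), S.card = l + 1 →
    w < ∑ c ∈ S, cellWeight c + cellWeight a + cellWeight b → detBracket n k (squarefree S) a b ∈ Z)

include ih in
theorem detBracket_mem_of_conflicts {D : Finset (Fin n × Fin n)} {c : Fin n × Fin n}
    (hD : D.card = l) (hc : Conflicts c D) {a b : Fin n × Fin n}
    (hw : w ≤ ∑ c ∈ D, cellWeight c + cellWeight c + cellWeight a + cellWeight b) :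
    detBracket n k (X c * squarefree D) a b ∈ Z := by
  by_cases hcD : c ∈ D
  · rw [← X_mul_squarefree_erase hcD, detBracket_eq_zero (Or.inl rfl)]
    exact Z.zero_mem
  · rw [← squarefree_insert hcD]
    obtain ⟨d, hd, hcd⟩ := hc
    refine detBracket_mem_of_not_chain (fun h => hcd (h c (Finset.mem_insert_self _ _) d
      (Finset.mem_insert_of_mem hd) fun e => hcD (e ▸ hd))) fun S' hS' hlt => ih S' a b ?_ ?_
    · rw [hS', Finset.card_insert_of_notMem hcD, hD]
    · rw [Finset.sum_insert hcD] at hlt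
      omega

-- In the Koszul relation of a, b and a cell c of S, the other two terms still contain a conflicting
-- pair and are straightened. The cell c must avoid one conflict witness for a and one for b, hence
-- |S| ≥ 3.
include hrow ih in
theorem detBracket_mem_of_conflicts_both (hl : 2 ≤ l) {S : Finset (Fin n × Fin n)}
    (hS : S.card = l + 1) {a b : Fin n × Fin n} (ha : Conflicts a S) (hb : Conflicts b S)
    (hw : w ≤ ∑ c ∈ S, cellWeight c + cellWeight a + cellWeight b) :
    detBracket n k (squarefree S) a b ∈ Z := by
  obtain ⟨d, hd, had⟩ := ha
  obtain ⟨e, he, hbe⟩ := hb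
  obtain ⟨c, hcS, hc⟩ : ∃ c ∈ S, c ∉ ({d, e} : Finset (Fin n × Fin n)) := by
    refine Finset.exists_mem_notMem_of_card_lt_card ?_
    have := Finset.card_le_two (a := d) (b := e)
    omega
  simp only [Finset.mem_insert, Finset.mem_singleton, not_or] at hc
  have hsum := Finset.add_sum_erase S cellWeight hcS
  have hD : (S.erase c).card = l := by rw [Finset.card_erase_of_mem hcS, hS]; rfl
  have h1 : detBracket n k (X a * squarefree (S.erase c)) b c ∈ Z :=
    detBracket_mem_of_conflicts ih hD ⟨d, Finset.mem_erase.2 ⟨Ne.symm hc.1, hd⟩, had⟩ (by omega)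
  have h2 : detBracket n k (X b * squarefree (S.erase c)) a c ∈ Z :=
    detBracket_mem_of_conflicts ih hD ⟨e, Finset.mem_erase.2 ⟨Ne.symm hc.2, he⟩, hbe⟩ (by omega)
  have h3 := hrow (S.erase c) hD a b c
  rw [koszulRow, X_mul_squarefree_erase hcS] at h3
  exact (Z.add_mem_iff_right (Z.sub_mem h1 h2)).1 h3

theorem card_erase_erase {σ : Type*} [DecidableEq σ] {E : Finset σ} {a b : σ} (ha : a ∈ E)
    (hb : b ∈ E) (hab : a ≠ b) {r : ℕ} (hE : E.card = r + 2) : ((E.erase a).erase b).card = r := by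
  rw [Finset.card_erase_of_mem (Finset.mem_erase.2 ⟨Ne.symm hab, hb⟩),
    Finset.card_erase_of_mem ha, hE]
  rfl

theorem X_mul_squarefree_erase_erase {σ : Type*} [DecidableEq σ] {E : Finset σ} {a b : σ}
    (ha : a ∈ E) (hab : a ≠ b) :
    X a * squarefree ((E.erase a).erase b) = squarefree (E.erase b) := by
  rw [Finset.erase_right_comm]
  exact X_mul_squarefree_erase (Finset.mem_erase.2 ⟨hab, ha⟩)

-- The third term of the Koszul relation of a, a', b has polynomial part X_b times the product of
-- the remaining cells; it contains a conflict and is straightened. The other two terms are thus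
-- congruent modulo `Z`.
include hrow ih in
theorem detBracket_sub_mem_of_conflicts_erase_erase {E : Finset (Fin n × Fin n)}
    (hE : E.card = l + 2) {a a' b : Fin n × Fin n} (ha : a ∈ E) (ha' : a' ∈ E) (hne : a ≠ a')
    (hb : Conflicts b ((E.erase a).erase a')) (hw : w ≤ ∑ c ∈ E, cellWeight c + cellWeight b) :
    detBracket n k (squarefree (E.erase a)) a b - detBracket n k (squarefree (E.erase a')) a' b
      ∈ Z := by
  have hD := card_erase_erase ha ha' hne hE
  have hsum := Finset.add_sum_erase E cellWeight ha
  have hsum' := Finset.add_sum_erase (E.erase a) cellWeight (Finset.mem_erase.2 ⟨Ne.symm hne, ha'⟩)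
  have h1 : detBracket n k (X b * squarefree ((E.erase a).erase a')) a a' ∈ Z :=
    detBracket_mem_of_conflicts ih hD hb (by omega)
  have h2 := hrow _ hD a a' b
  rw [koszulRow, X_mul_squarefree_erase_erase ha hne,
    X_mul_squarefree_erase (Finset.mem_erase.2 ⟨Ne.symm hne, ha'⟩)] at h2
  rw [← neg_sub]
  exact Z.neg_mem ((Z.add_mem_iff_left h1).1 h2)

-- When b conflicts with E∖a and with E∖a' but with no other cell, it must conflict with both a and
-- a'. The comparison then passes through a third cell e of E, because removing {a, e} or {e, a'}
-- leaves a conflict.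
include hrow ih in
theorem detBracket_sub_mem_of_conflicts_erase (hl : 1 ≤ l) {E : Finset (Fin n × Fin n)}
    (hE : E.card = l + 2) {a a' b : Fin n × Fin n} (ha : a ∈ E) (ha' : a' ∈ E) (hne : a ≠ a')
    (hb : Conflicts b (E.erase a)) (hb' : Conflicts b (E.erase a'))
    (hw : w ≤ ∑ c ∈ E, cellWeight c + cellWeight b) :
    detBracket n k (squarefree (E.erase a)) a b - detBracket n k (squarefree (E.erase a')) a' b
      ∈ Z := by
  by_cases h : Conflicts b ((E.erase a).erase a')
  · exact detBracket_sub_mem_of_conflicts_erase_erase hrow ih hE ha ha' hne h hw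
  have hD := card_erase_erase ha ha' hne hE
  obtain ⟨e, he⟩ : ((E.erase a).erase a').Nonempty := Finset.card_pos.1 (by omega)
  simp only [Finset.mem_erase] at he
  rw [not_conflicts_iff] at h
  have hca' : ¬Comparable b a' := by
    obtain ⟨d, hd, hbd⟩ := hb
    by_cases hda : d = a'
    · rwa [← hda]
    · exact absurd (h d (Finset.mem_erase.2 ⟨hda, hd⟩)) hbd
  have hca : ¬Comparable b a := by
    obtain ⟨d, hd, hbd⟩ := hb'
    by_cases hda : d = a
    · rwa [← hda]
    · refine absurd (h d ?_) hbd
      simp only [Finset.mem_erase] at hd ⊢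
      exact ⟨hd.1, hda, hd.2⟩
  have h1 := detBracket_sub_mem_of_conflicts_erase_erase hrow ih hE ha he.2.2 (Ne.symm he.2.1)
    ⟨a', by simp [ha', Ne.symm he.1, Ne.symm hne], hca'⟩ hw
  have h2 := detBracket_sub_mem_of_conflicts_erase_erase hrow ih hE he.2.2 ha' he.1
    ⟨a, by simp [ha, Ne.symm he.2.1, hne], hca⟩ hw
  simpa using Z.add_mem h1 h2

/-- The cell `a` of the chain `E` is admissible for the choice of a normal form of the brackets
with `E` and `b`. -/
def Admissible (E : Finset (Fin n × Fin n)) (b a : Fin n × Fin n) : Prop :=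
  a ∈ E ∧ (Conflicts b (E.erase a) ∨ ¬Conflicts b E ∧ ∀ e ∈ E, e ≠ a → Below a e)

theorem exists_admissible {E : Finset (Fin n × Fin n)} (hE : IsCellChain E) (hcard : 2 ≤ E.card)
    (b : Fin n × Fin n) : ∃ a, Admissible E b a := by
  by_cases h : Conflicts b E
  · obtain ⟨d, hd, hbd⟩ := h
    obtain ⟨a, ha, had⟩ := Finset.exists_mem_ne (by omega : 1 < E.card) d
    exact ⟨a, ha, Or.inl ⟨d, Finset.mem_erase.2 ⟨Ne.symm had, hd⟩, hbd⟩⟩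
  · obtain ⟨a, ha, hmin⟩ := hE.exists_least (Finset.card_pos.1 (by omega))
    exact ⟨a, ha, Or.inr ⟨h, hmin⟩⟩

variable
  (hnf : ∀ (E : Finset (Fin n × Fin n)) (b : Fin n × Fin n), IsCellChain E → E.card = l + 2 →
    ¬(∀ e ∈ E, Below b e) → ∃ a, Admissible E b a ∧ detBracket n k (squarefree (E.erase a)) a b ∈ Z)

-- Since b conflicts with E, the removed cell supplied by `hnf` must also leave a conflict, so its
-- bracket differs from any other such bracket by an element of `Z`.
include hrow ih hnf in
theorem detBracket_mem_of_conflicts_erase (hl : 1 ≤ l) {E : Finset (Fin n × Fin n)}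
    (hch : IsCellChain E) (hE : E.card = l + 2) {a b : Fin n × Fin n} (ha : a ∈ E)
    (hb : Conflicts b (E.erase a)) (hw : w ≤ ∑ c ∈ E, cellWeight c + cellWeight b) :
    detBracket n k (squarefree (E.erase a)) a b ∈ Z := by
  have hbE := hb.mono (Finset.erase_subset _ _)
  obtain ⟨a₀, ⟨ha₀, hadm⟩, hmem⟩ := hnf E b hch hE (fun h => by
    obtain ⟨d, hd, hbd⟩ := hbE
    exact hbd (Or.inl (h d hd)))
  have hb₀ : Conflicts b (E.erase a₀) := hadm.resolve_right fun h => h.1 hbE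
  by_cases hne : a = a₀
  · rwa [hne]
  · have := detBracket_sub_mem_of_conflicts_erase hrow ih hl hE ha ha₀ hne hb hb₀ hw
    exact (Z.sub_mem_iff_left hmem).1 this

-- The Koszul relation with a cell e of S expresses the bracket through e∧b, taken with the chain S
-- ∪ {a}, and e∧a, taken with S ∪ {b}. In each case a and b supply the conflict that remains after e
-- is removed.
include hrow ih hnf in
theorem detBracket_mem_of_conflicts_only (hl : 1 ≤ l) {S : Finset (Fin n × Fin n)}
    (hS : S.card = l + 1) (hch : IsCellChain S) {a b : Fin n × Fin n} (ha : ¬Conflicts a S)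
    (hb : ¬Conflicts b S) (hab : ¬Comparable b a)
    (hw : w ≤ ∑ c ∈ S, cellWeight c + cellWeight a + cellWeight b) :
    detBracket n k (squarefree S) a b ∈ Z := by
  have hout : ∀ c, ¬Conflicts c S → c ∉ S := fun c hc hcS =>
    hc ⟨c, hcS, not_comparable_self c⟩
  have haS := hout a ha
  have hbS := hout b hb
  obtain ⟨e, he⟩ : S.Nonempty := Finset.card_pos.1 (by omega)
  have key : ∀ p q, p ∉ S → ¬Conflicts p S → ¬Comparable q p →
      w ≤ ∑ c ∈ S, cellWeight c + cellWeight p + cellWeight q →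
      detBracket n k (X p * squarefree (S.erase e)) e q ∈ Z := by
    intro p q hpS hp hqp hw
    have hpe : p ≠ e := fun h => hpS (h ▸ he)
    have heq : X p * squarefree (S.erase e) = squarefree ((insert p S).erase e) := by
      rw [Finset.erase_insert_of_ne hpe, squarefree_insert]
      exact fun h => hpS (Finset.mem_of_mem_erase h)
    rw [heq]
    refine detBracket_mem_of_conflicts_erase hrow ih hnf hl (hch.insert (not_conflicts_iff.1 hp)) ?_
      (Finset.mem_insert_of_mem he)
      ⟨p, Finset.mem_erase.2 ⟨hpe, Finset.mem_insert_self _ _⟩, hqp⟩ ?_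
    · rw [Finset.card_insert_of_notMem hpS, hS]
    · rw [Finset.sum_insert hpS]
      omega
  have h1 := key a b haS ha hab hw
  have h2 := key b a hbS hb (fun h => hab h.symm) (by omega)
  have hD : (S.erase e).card = l := by rw [Finset.card_erase_of_mem he, hS]; rfl
  have h3 := hrow (S.erase e) hD a b e
  rw [koszulRow, X_mul_squarefree_erase he, ← detBracket, ← detBracket,
    detBracket_swap _ b e, detBracket_swap _ a e] at h3
  exact (Z.add_mem_iff_right (Z.sub_mem (Z.neg_mem h1) (Z.neg_mem h2))).1 h3

-- Here b is comparable to every other cell of F, so the only admissible choice for the chain F∖b is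
-- its least cell, namely f.
include hnf in
theorem detBracket_mem_of_least {F : Finset (Fin n × Fin n)} (hch : IsCellChain F)
    (hF : F.card = l + 3) {f b : Fin n × Fin n} (hf : f ∈ F) (hmin : ∀ e ∈ F, e ≠ f → Below f e)
    (hb : b ∈ F) (hbf : b ≠ f) :
    detBracket n k (squarefree ((F.erase b).erase f)) f b ∈ Z := by
  have hfE : f ∈ F.erase b := Finset.mem_erase.2 ⟨Ne.symm hbf, hf⟩
  obtain ⟨a₀, ⟨ha₀, hadm⟩, hmem⟩ := hnf (F.erase b) b (hch.mono (Finset.erase_subset _ _))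
    (by rw [Finset.card_erase_of_mem hb, hF]; rfl) (fun h => (h f hfE).not_below (hmin b hb hbf))
  have hnc : ¬Conflicts b (F.erase b) := by
    rw [not_conflicts_iff]
    intro d hd
    rw [Finset.mem_erase] at hd
    exact hch b hb d hd.2 (Ne.symm hd.1)
  rcases hadm with h | h
  · exact absurd (h.mono (Finset.erase_subset _ _)) hnc
  · have : a₀ = f := by
      by_contra hne
      exact (h.2 f hfE (Ne.symm hne)).not_below (hmin a₀ (Finset.mem_of_mem_erase ha₀) hne)
    rwa [this] at hmem

-- The Koszul relation of f, a, b, with f least in F, reduces a∧b to f∧a and f∧b. Thus only the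
-- brackets containing the least cell of F are needed.
include hrow hnf in
theorem detBracket_mem_of_chain {F : Finset (Fin n × Fin n)} (hch : IsCellChain F)
    (hF : F.card = l + 3) {a b : Fin n × Fin n} (ha : a ∈ F) (hb : b ∈ F) (hab : a ≠ b) :
    detBracket n k (squarefree ((F.erase b).erase a)) a b ∈ Z := by
  obtain ⟨f, hf, hmin⟩ := hch.exists_least ⟨a, ha⟩
  by_cases haf : a = f
  · subst haf
    exact detBracket_mem_of_least hnf hch hF ha hmin hb (Ne.symm hab)
  by_cases hbf : b = f
  · subst hbf
    rw [Finset.erase_right_comm, detBracket_swap]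
    exact Z.neg_mem (detBracket_mem_of_least hnf hch hF hb hmin ha hab)
  have h1 := detBracket_mem_of_least hnf hch hF hf hmin hb hbf
  have h2 := detBracket_mem_of_least hnf hch hF hf hmin ha haf
  have hfD : f ∈ (F.erase b).erase a := by simp [hf, Ne.symm haf, Ne.symm hbf]
  have hD : (((F.erase b).erase a).erase f).card = l := by
    rw [Finset.card_erase_of_mem hfD, card_erase_erase hb ha (Ne.symm hab) (r := l + 1) hF]
    rfl
  have h3 := hrow _ hD f a b
  have e1 : X a * squarefree (((F.erase b).erase a).erase f) = squarefree ((F.erase b).erase f) :=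
    X_mul_squarefree_erase_erase (Finset.mem_erase.2 ⟨hab, ha⟩) haf
  have e2 : X b * squarefree (((F.erase b).erase a).erase f) = squarefree ((F.erase a).erase f) := by
    rw [Finset.erase_right_comm (a := b)]
    exact X_mul_squarefree_erase_erase (Finset.mem_erase.2 ⟨Ne.symm hab, hb⟩) hbf
  rw [koszulRow, X_mul_squarefree_erase hfD, e1, e2] at h3
  exact (Z.sub_mem_iff_left h1).1 ((Z.add_mem_iff_left h2).1 h3)

include hrow ih hnf in
theorem detBracket_mem_of_not_conflicts (hl : 1 ≤ l) {S : Finset (Fin n × Fin n)}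
    (hS : S.card = l + 1) (hch : IsCellChain S) {a b : Fin n × Fin n} (ha : ¬Conflicts a S)
    (hw : w ≤ ∑ c ∈ S, cellWeight c + cellWeight a + cellWeight b) :
    detBracket n k (squarefree S) a b ∈ Z := by
  have hout : ∀ c, ¬Conflicts c S → c ∉ S := fun c hc hcS =>
    hc ⟨c, hcS, not_comparable_self c⟩
  have haS := hout a ha
  have hE := hch.insert (not_conflicts_iff.1 ha)
  by_cases hb : Conflicts b S
  · have := detBracket_mem_of_conflicts_erase hrow ih hnf hl hE
      (by rw [Finset.card_insert_of_notMem haS, hS]) (Finset.mem_insert_self a S)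
      (by rwa [Finset.erase_insert haS]) (b := b) (by rw [Finset.sum_insert haS]; omega)
    rwa [Finset.erase_insert haS] at this
  by_cases hab : Comparable b a
  · have hbE : b ∉ insert a S := by
      rw [Finset.mem_insert, not_or]
      exact ⟨fun h => not_comparable_self a (h ▸ hab), hout b hb⟩
    have hF : IsCellChain (insert b (insert a S)) := hE.insert fun d hd => by
      rcases Finset.mem_insert.1 hd with rfl | hd
      · exact hab
      · exact not_conflicts_iff.1 hb d hd
    have := detBracket_mem_of_chain hrow hnf hF
      (by rw [Finset.card_insert_of_notMem hbE, Finset.card_insert_of_notMem haS, hS])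
      (a := a) (b := b) (by simp) (by simp)
      (fun h => not_comparable_self a (h ▸ hab))
    rwa [Finset.erase_insert hbE, Finset.erase_insert haS] at this
  · exact detBracket_mem_of_conflicts_only hrow ih hnf hl hS hch ha hb hab hw

include hrow ih hnf in
theorem detBracket_mem_step (hl : 2 ≤ l) {S : Finset (Fin n × Fin n)}
    (hS : S.card = l + 1) {a b : Fin n × Fin n}
    (hw : w ≤ ∑ c ∈ S, cellWeight c + cellWeight a + cellWeight b) :
    detBracket n k (squarefree S) a b ∈ Z := by
  by_cases hch : IsCellChain S
  swap
  · exact detBracket_mem_of_not_chain hch fun S' hS' hlt => ih S' a b (hS'.trans hS) (by omega)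
  by_cases ha : Conflicts a S
  · by_cases hb : Conflicts b S
    · exact detBracket_mem_of_conflicts_both hrow ih hl hS ha hb hw
    · rw [detBracket_swap]
      exact Z.neg_mem (detBracket_mem_of_not_conflicts hrow ih hnf (by omega) hS hch hb (by omega))
  · exact detBracket_mem_of_not_conflicts hrow ih hnf (by omega) hS hch ha hw

include hrow hnf in
theorem detBracket_mem (hl : 2 ≤ l) {S : Finset (Fin n × Fin n)} (hS : S.card = l + 1)
    (a b : Fin n × Fin n) : detBracket n k (squarefree S) a b ∈ Z := by
  have hbound : ∀ (S : Finset (Fin n × Fin n)) (a b : Fin n × Fin n),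
      ∑ c ∈ S, cellWeight c + cellWeight a + cellWeight b ≤ 3 * ∑ c : Fin n × Fin n, cellWeight c := by
    intro S a b
    have h1 : ∑ c ∈ S, cellWeight c ≤ ∑ c : Fin n × Fin n, cellWeight c :=
      Finset.sum_le_sum_of_subset (Finset.subset_univ S)
    have h2 := Finset.single_le_sum (f := cellWeight) (fun _ _ => Nat.zero_le _) (Finset.mem_univ a)
    have h3 := Finset.single_le_sum (f := cellWeight) (fun _ _ => Nat.zero_le _) (Finset.mem_univ b)
    omega
  -- Descending induction on the weight, run as induction on `t`, which bounds how far the weight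
  -- lies below its maximum.
  have key : ∀ (t : ℕ) (S : Finset (Fin n × Fin n)) (a b : Fin n × Fin n), S.card = l + 1 →
      3 * ∑ c : Fin n × Fin n, cellWeight c <
        ∑ c ∈ S, cellWeight c + cellWeight a + cellWeight b + t →
      detBracket n k (squarefree S) a b ∈ Z := by
    intro t
    induction t with
    | zero =>
      intro S a b _ h
      exact absurd (hbound S a b) (by omega)
    | succ t ih =>
      intro S a b hS h
      exact detBracket_mem_step hrow
        (w := ∑ c ∈ S, cellWeight c + cellWeight a + cellWeight b)
        (fun S' a' b' hS' hlt => ih S' a' b' hS' (by omega)) hnf hl hS le_rfl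
  exact key (3 * ∑ c : Fin n × Fin n, cellWeight c + 1) S a b hS (by omega)

end Reduction

/-! ### Counting chains and normal forms. -/

/-- The chain of cells with given sets of rows and columns. -/
def cellChain {n k : ℕ} (I J : {s : Finset (Fin n) // s.card = k}) : Finset (Fin n × Fin n) :=
  Finset.univ.image fun t : Fin k => (I.1.orderEmbOfFin I.2 t, J.1.orderEmbOfFin J.2 t)

theorem isCellChain_cellChain {n k : ℕ} (I J : {s : Finset (Fin n) // s.card = k}) :
    IsCellChain (cellChain I J) := by
  intro a ha b hb hab
  obtain ⟨s, -, rfl⟩ := Finset.mem_image.1 ha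
  obtain ⟨t, -, rfl⟩ := Finset.mem_image.1 hb
  rcases lt_trichotomy s t with h | h | h
  · exact Or.inl ⟨(OrderEmbedding.lt_iff_lt _).2 h, (OrderEmbedding.lt_iff_lt _).2 h⟩
  · exact absurd (by rw [h]) hab
  · exact Or.inr ⟨(OrderEmbedding.lt_iff_lt _).2 h, (OrderEmbedding.lt_iff_lt _).2 h⟩

theorem card_cellChain {n k : ℕ} (I J : {s : Finset (Fin n) // s.card = k}) :
    (cellChain I J).card = k := by
  rw [cellChain, Finset.card_image_of_injective, Finset.card_univ, Fintype.card_fin]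
  exact fun s t h => (I.1.orderEmbOfFin I.2).injective (Prod.ext_iff.1 h).1

theorem image_fst_cellChain {n k : ℕ} (I J : {s : Finset (Fin n) // s.card = k}) :
    (cellChain I J).image Prod.fst = I.1 := by
  rw [cellChain, Finset.image_image]
  exact Finset.image_orderEmbOfFin_univ I.1 I.2

theorem image_snd_cellChain {n k : ℕ} (I J : {s : Finset (Fin n) // s.card = k}) :
    (cellChain I J).image Prod.snd = J.1 := by
  rw [cellChain, Finset.image_image]
  exact Finset.image_orderEmbOfFin_univ J.1 J.2

theorem IsCellChain.injOn_fst {n : ℕ} {S : Finset (Fin n × Fin n)} (hS : IsCellChain S) :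
    Set.InjOn Prod.fst (S : Set (Fin n × Fin n)) := by
  intro a ha b hb h
  by_contra hab
  rcases hS a ha b hb hab with h' | h'
  · exact h'.1.ne h
  · exact h'.1.ne' h

theorem IsCellChain.injOn_snd {n : ℕ} {S : Finset (Fin n × Fin n)} (hS : IsCellChain S) :
    Set.InjOn Prod.snd (S : Set (Fin n × Fin n)) := by
  intro a ha b hb h
  by_contra hab
  rcases hS a ha b hb hab with h' | h'
  · exact h'.2.ne h
  · exact h'.2.ne' h

/-- A chain is the graph of an increasing bijection from its rows to its columns, and such a
bijection is unique. -/
theorem IsCellChain.eq_cellChain {n k : ℕ} {S : Finset (Fin n × Fin n)} (hS : IsCellChain S)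
    (I J : {s : Finset (Fin n) // s.card = k}) (hI : S.image Prod.fst = I.1)
    (hJ : S.image Prod.snd = J.1) : S = cellChain I J := by
  have hex : ∀ t : Fin k, ∃ c ∈ S, c.1 = I.1.orderEmbOfFin I.2 t := by
    intro t
    have : I.1.orderEmbOfFin I.2 t ∈ S.image Prod.fst := by
      rw [hI]
      exact Finset.orderEmbOfFin_mem _ _ _
    simpa only [Finset.mem_image] using this
  choose c hcS hc using hex
  have hmono : StrictMono fun t => (c t).2 := by
    intro s t hst
    have hlt : (c s).1 < (c t).1 := by
      rw [hc, hc]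
      exact (OrderEmbedding.lt_iff_lt _).2 hst
    rcases hS _ (hcS s) _ (hcS t) (fun h => hlt.ne (congrArg Prod.fst h)) with h | h
    · exact h.2
    · exact absurd h.1 (not_lt.2 hlt.le)
  have hsnd := Finset.orderEmbOfFin_unique J.2
    (fun t => hJ ▸ Finset.mem_image_of_mem Prod.snd (hcS t)) hmono
  symm
  refine Finset.eq_of_subset_of_card_le ?_ ?_
  · rw [cellChain, Finset.image_subset_iff]
    intro t _
    have : (I.1.orderEmbOfFin I.2 t, J.1.orderEmbOfFin J.2 t) = c t :=
      Prod.ext (hc t).symm (congrFun hsnd t).symm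
    rw [this]
    exact hcS t
  · rw [card_cellChain, ← Finset.card_image_of_injOn hS.injOn_fst, hI, I.2]

open scoped Classical in
theorem card_cellChains (n k : ℕ) :
    Fintype.card {S : Finset (Fin n × Fin n) // IsCellChain S ∧ S.card = k} = n.choose k ^ 2 := by
  have h : Fintype.card ({s : Finset (Fin n) // s.card = k} × {s : Finset (Fin n) // s.card = k}) =
      n.choose k ^ 2 := by
    rw [Fintype.card_prod, Fintype.card_finset_len, Fintype.card_fin, sq]
  rw [← h]
  refine Fintype.card_congr
    ⟨fun S => (⟨S.1.image Prod.fst, ?_⟩, ⟨S.1.image Prod.snd, ?_⟩),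
      fun x => ⟨cellChain x.1 x.2, isCellChain_cellChain _ _, card_cellChain _ _⟩, ?_, ?_⟩
  · rw [Finset.card_image_of_injOn S.2.1.injOn_fst, S.2.2]
  · rw [Finset.card_image_of_injOn S.2.1.injOn_snd, S.2.2]
  · intro S
    exact Subtype.ext (S.2.1.eq_cellChain _ _ rfl rfl).symm
  · intro x
    exact Prod.ext (Subtype.ext (image_fst_cellChain _ _)) (Subtype.ext (image_snd_cellChain _ _))

-- The excluded pairs (E, b) include those obtained from a chain of k + 2 cells by splitting off its
-- least cell, and the chain is recovered from the pair.
open scoped Classical in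
theorem card_normalForms_le (n k : ℕ) :
    Fintype.card {x : {S : Finset (Fin n × Fin n) // IsCellChain S ∧ S.card = k + 1} ×
      (Fin n × Fin n) // ¬∀ e ∈ x.1.1, Below x.2 e} + n.choose (k + 2) ^ 2 ≤
      n ^ 2 * n.choose (k + 1) ^ 2 := by
  have hinj : n.choose (k + 2) ^ 2 ≤ Fintype.card
      {x : {S : Finset (Fin n × Fin n) // IsCellChain S ∧ S.card = k + 1} ×
        (Fin n × Fin n) // ∀ e ∈ x.1.1, Below x.2 e} := by
    rw [← card_cellChains]
    have hex : ∀ F : {S : Finset (Fin n × Fin n) // IsCellChain S ∧ S.card = k + 2},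
        ∃ a ∈ F.1, ∀ e ∈ F.1, e ≠ a → Below a e := fun F =>
      F.2.1.exists_least (Finset.card_pos.1 (by rw [F.2.2]; omega))
    choose a ha hmin using hex
    refine Fintype.card_le_of_injective (fun F => ⟨(⟨F.1.erase (a F),
      F.2.1.mono (Finset.erase_subset _ _), ?_⟩, a F), ?_⟩) ?_
    · rw [Finset.card_erase_of_mem (ha F), F.2.2]
      rfl
    · intro e he
      rw [Finset.mem_erase] at he
      exact hmin F e he.2 he.1
    · intro F G h
      have h1 : F.1.erase (a F) = G.1.erase (a G) :=
        congrArg (fun x => x.1.1.1) h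
      have h2 : a F = a G := congrArg (fun x => x.1.2) h
      refine Subtype.ext ?_
      rw [← Finset.insert_erase (ha F), ← Finset.insert_erase (ha G), h1, h2]
  have htot : Fintype.card ({S : Finset (Fin n × Fin n) // IsCellChain S ∧ S.card = k + 1} ×
      (Fin n × Fin n)) = n ^ 2 * n.choose (k + 1) ^ 2 := by
    rw [Fintype.card_prod, card_cellChains, Fintype.card_prod, Fintype.card_fin]
    ring
  rw [Fintype.card_subtype_compl, htot]
  have hle := Fintype.card_subtype_le
    (fun x : {S : Finset (Fin n × Fin n) // IsCellChain S ∧ S.card = k + 1} ×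
      (Fin n × Fin n) => ∀ e ∈ x.1.1, Below x.2 e)
  rw [htot] at hle
  omega

/-! ### Independence of the brackets and the rank of the flattening. -/

/-- The complementary set of rows or columns. -/
def complement {n m k : ℕ} (h : k + m = n) (I : {s : Finset (Fin n) // s.card = m}) :
    {s : Finset (Fin n) // s.card = k} :=
  ⟨I.1ᶜ, by rw [Finset.card_compl, Fintype.card_fin, I.2]; omega⟩

theorem apolar_squarefree_mul_eq_zero {n : ℕ} {S T : Finset (Fin n × Fin n)}
    {a b : Fin n × Fin n} (ha : a ∈ S) (hb : b ∈ T) (h : a.1 = b.1 ∨ a.2 = b.2) :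
    apolar (squarefree S * squarefree T) (detForm n : MvPolynomial (Fin n × Fin n) ℂ) = 0 := by
  rw [← X_mul_squarefree_erase ha, ← X_mul_squarefree_erase hb,
    show X a * squarefree (S.erase a) * (X b * squarefree (T.erase b)) =
      X a * (X b * (squarefree (S.erase a) * squarefree (T.erase b))) by ring]
  exact apolar_detForm_mul_eq_zero h _

theorem exists_mem_notMem_of_card_eq {α : Type*} {s t : Finset α} (h : s.card = t.card)
    (hne : s ≠ t) : ∃ i ∈ s, i ∉ t := by
  by_contra! hsub
  exact hne (Finset.eq_of_subset_of_card_le hsub h.ge)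

/-- If the row or column sets differ, some cell of one chain shares a row or column with a cell of
the complementary chain of the other. -/
theorem apolar_cellChain_eq_zero {n m k : ℕ} (h : k + m = n)
    {I J I' J' : {s : Finset (Fin n) // s.card = m}} (hne : (I, J) ≠ (I', J')) :
    apolar (squarefree (cellChain (complement h I') (complement h J')) *
      squarefree (cellChain I J)) (detForm n : MvPolynomial (Fin n × Fin n) ℂ) = 0 := by
  by_cases hI : I.1 = I'.1
  · have hJ : J.1 ≠ J'.1 := fun hJ => hne (Prod.ext (Subtype.ext hI) (Subtype.ext hJ))
    obtain ⟨j, hj, hj'⟩ := exists_mem_notMem_of_card_eq (J.2.trans J'.2.symm) hJ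
    have h1 : j ∈ (cellChain I J).image Prod.snd := by rwa [image_snd_cellChain]
    have h2 : j ∈ (cellChain (complement h I') (complement h J')).image Prod.snd := by
      rw [image_snd_cellChain]
      exact Finset.mem_compl.2 hj'
    obtain ⟨a, ha, rfl⟩ := Finset.mem_image.1 h1
    obtain ⟨b, hb, hab⟩ := Finset.mem_image.1 h2
    exact apolar_squarefree_mul_eq_zero hb ha (Or.inr hab)
  · obtain ⟨j, hj, hj'⟩ := exists_mem_notMem_of_card_eq (I.2.trans I'.2.symm) hI
    have h1 : j ∈ (cellChain I J).image Prod.fst := by rwa [image_fst_cellChain]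
    have h2 : j ∈ (cellChain (complement h I') (complement h J')).image Prod.fst := by
      rw [image_fst_cellChain]
      exact Finset.mem_compl.2 hj'
    obtain ⟨a, ha, rfl⟩ := Finset.mem_image.1 h1
    obtain ⟨b, hb, hab⟩ := Finset.mem_image.1 h2
    exact apolar_squarefree_mul_eq_zero hb ha (Or.inl hab)

/-- A chain together with the complementary chain is the graph of a permutation, so the product is a
single monomial of the determinant. -/
theorem apolar_cellChain_ne_zero {n m k : ℕ} (h : k + m = n)
    (I J : {s : Finset (Fin n) // s.card = m}) :
    apolar (squarefree (cellChain (complement h I) (complement h J)) *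
      squarefree (cellChain I J)) (detForm n : MvPolynomial (Fin n × Fin n) ℂ) ≠ 0 := by
  set B := cellChain (complement h I) (complement h J) with hB
  have hdisj : Disjoint B (cellChain I J) := by
    rw [Finset.disjoint_left]
    intro c hcB hc
    have h1 : c.1 ∈ (cellChain I J).image Prod.fst := Finset.mem_image_of_mem _ hc
    have h2 : c.1 ∈ B.image Prod.fst := Finset.mem_image_of_mem _ hcB
    rw [image_fst_cellChain] at h1 h2
    exact Finset.mem_compl.1 h2 h1
  have hprod : squarefree B * squarefree (cellChain I J) = squarefree (B ∪ cellChain I J) :=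
    (Finset.prod_union hdisj).symm
  have hcard : (B ∪ cellChain I J).card = n := by
    rw [Finset.card_union_of_disjoint hdisj, hB, card_cellChain, card_cellChain, h]
  have hfst : (B ∪ cellChain I J).image Prod.fst = Finset.univ := by
    rw [Finset.image_union, hB, image_fst_cellChain, image_fst_cellChain]
    exact (Finset.union_comm _ _).trans (Finset.union_compl I.1)
  have hsnd : (B ∪ cellChain I J).image Prod.snd = Finset.univ := by
    rw [Finset.image_union, hB, image_snd_cellChain, image_snd_cellChain]
    exact (Finset.union_comm _ _).trans (Finset.union_compl J.1)
  have hex : ∀ j : Fin n, ∃ i, (i, j) ∈ B ∪ cellChain I J := by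
    intro j
    have : j ∈ (B ∪ cellChain I J).image Prod.snd := by rw [hsnd]; exact Finset.mem_univ j
    obtain ⟨c, hc, rfl⟩ := Finset.mem_image.1 this
    exact ⟨c.1, hc⟩
  choose r hr using hex
  have himg : (Finset.univ.image fun j => (r j, j)) = B ∪ cellChain I J := by
    refine Finset.eq_of_subset_of_card_le (Finset.image_subset_iff.2 fun j _ => hr j) ?_
    rw [hcard, Finset.card_image_of_injective _ fun i j hij => (Prod.ext_iff.1 hij).2,
      Finset.card_univ, Fintype.card_fin]
  have hsurj : Function.Surjective r := by
    intro i
    have : i ∈ (B ∪ cellChain I J).image Prod.fst := by rw [hfst]; exact Finset.mem_univ i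
    rw [← himg, Finset.image_image] at this
    obtain ⟨j, -, hj⟩ := Finset.mem_image.1 this
    exact ⟨j, hj⟩
  rw [hprod]
  exact apolar_squarefree_detForm_ne_zero
    (Equiv.ofBijective r (Finite.surjective_iff_bijective.1 hsurj)) himg.symm

theorem linearIndependent_of_diagonal {ι Y K : Type*} [Field K] (v : ι → Y → K) (y : ι → Y)
    (hoff : ∀ i j, i ≠ j → v i (y j) = 0) (hdiag : ∀ i, v i (y i) ≠ 0) :
    LinearIndependent K v := by
  rw [linearIndependent_iff']
  intro s g hg i hi
  have := congrFun hg (y i)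
  rw [Finset.sum_apply, Finset.sum_eq_single i] at this
  · exact (mul_eq_zero.1 this).resolve_right (hdiag i)
  · intro j _ hj
    rw [Pi.smul_apply, hoff j i hj, smul_zero]
  · exact fun h => absurd hi h

theorem linearIndependent_detBracket {n m k : ℕ} (h : k + m = n)
    {f g : {t : Finset (Fin n × Fin n) // t.card = 2} → Fin n × Fin n}
    (hfg : ∀ t, f t ≠ g t ∧ t.1 = {f t, g t}) :
    LinearIndependent ℂ fun x : ({s : Finset (Fin n) // s.card = m} ×
      {s : Finset (Fin n) // s.card = m}) × {t : Finset (Fin n × Fin n) // t.card = 2} =>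
      detBracket n k (squarefree (cellChain x.1.1 x.1.2)) (f x.2) (g x.2) := by
  refine linearIndependent_of_diagonal _
    (fun x => (⟨cellChain (complement h x.1.1) (complement h x.1.2), card_cellChain _ _⟩,
      f x.2, g x.2)) ?_ ?_
  · intro x y hxy
    simp only [bracket]
    by_cases h1 : x.1 = y.1
    · have h2 : x.2 ≠ y.2 := fun h2 => hxy (Prod.ext h1 h2)
      have hpair : wedgePair (f x.2) (g x.2) (f y.2) (g y.2) = 0 := by
        rw [wedgePair, if_neg, if_neg, sub_zero]
        · rintro ⟨e1, e2⟩
          refine h2 (Subtype.ext ?_)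
          rw [(hfg x.2).2, (hfg y.2).2, e1, e2, Finset.pair_comm]
        · rintro ⟨e1, e2⟩
          refine h2 (Subtype.ext ?_)
          rw [(hfg x.2).2, (hfg y.2).2, e1, e2]
      rw [hpair, mul_zero]
    · rw [apolar_cellChain_eq_zero h (I := x.1.1) (J := x.1.2) (I' := y.1.1) (J' := y.1.2) h1,
        zero_mul]
  · intro x
    simp only [bracket]
    refine mul_ne_zero (apolar_cellChain_ne_zero h _ _) ?_
    rw [wedgePair, if_pos ⟨rfl, rfl⟩, if_neg fun e => (hfg x.2).1 e.1, sub_zero]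
    exact one_ne_zero

theorem le_rank_koszulMatrix_detForm {n k l : ℕ} (h : k + (1 + l) = n) (hl : 2 ≤ l) :
    n.choose (l + 1) ^ 2 * (n ^ 2).choose 2 + n.choose (l + 3) ^ 2 ≤
      (koszulMatrix k l (detForm n : MvPolynomial (Fin n × Fin n) ℂ)).rank +
        n ^ 2 * n.choose (l + 2) ^ 2 := by
  classical
  obtain ⟨f, g, hfg⟩ := exists_pair_of_card_two (σ := Fin n × Fin n)
  have hadm : ∀ x : {x : {S : Finset (Fin n × Fin n) // IsCellChain S ∧ S.card = l + 1 + 1} ×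
      (Fin n × Fin n) // ¬∀ e ∈ x.1.1, Below x.2 e}, ∃ a, Admissible x.1.1.1 x.1.2 a := fun x =>
    exists_admissible x.1.1.2.1 (by rw [x.1.1.2.2]; omega) _
  choose a ha using hadm
  set R := Submodule.span ℂ
    (Set.range (koszulMatrix k l (detForm n : MvPolynomial (Fin n × Fin n) ℂ)).row) with hR
  -- `U` is spanned by one bracket per normal form, so the rows in `R` together with `U` contain all
  -- brackets, and the rank is at least the number of independent brackets minus the number of
  -- normal forms.
  set U := Submodule.span ℂ (Set.range fun x => detBracket n k
    (squarefree (x.1.1.1.erase (a x))) (a x) x.1.2) with hU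
  have hmem : ∀ S : Finset (Fin n × Fin n), S.card = l + 1 → ∀ p q,
      detBracket n k (squarefree S) p q ∈ R ⊔ U := by
    intro S hS p q
    refine detBracket_mem (l := l) ?_ ?_ hl hS p q
    · intro D hD p q r
      exact Submodule.mem_sup_left (Submodule.subset_span ⟨(⟨D, hD⟩, p, q, r), rfl⟩)
    · intro E b hE hcard hb
      exact ⟨a ⟨(⟨E, hE, hcard⟩, b), hb⟩, ha ⟨(⟨E, hE, hcard⟩, b), hb⟩,
        Submodule.mem_sup_right (Submodule.subset_span ⟨⟨(⟨E, hE, hcard⟩, b), hb⟩, rfl⟩)⟩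
  have hind := linearIndependent_detBracket (n := n) (m := l + 1) (k := k) (by omega) hfg
  have hle := finrank_span_eq_card hind
  have hsub := Submodule.finrank_mono (Submodule.span_le.2 (Set.range_subset_iff.2
    fun x : ({s : Finset (Fin n) // s.card = l + 1} ×
      {s : Finset (Fin n) // s.card = l + 1}) × {t : Finset (Fin n × Fin n) // t.card = 2} =>
    hmem (cellChain x.1.1 x.1.2) (card_cellChain _ _) (f x.2) (g x.2)))
  rw [hle] at hsub
  have hcard : Fintype.card (({s : Finset (Fin n) // s.card = l + 1} ×
      {s : Finset (Fin n) // s.card = l + 1}) × {t : Finset (Fin n × Fin n) // t.card = 2}) =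
      n.choose (l + 1) ^ 2 * (n ^ 2).choose 2 := by
    rw [Fintype.card_prod, Fintype.card_prod, Fintype.card_finset_len, Fintype.card_finset_len,
      Fintype.card_prod, Fintype.card_fin, sq, sq]
  have hadd := Submodule.finrank_add_le_finrank_add_finrank R U
  have hrank : Module.finrank ℂ R =
      (koszulMatrix k l (detForm n : MvPolynomial (Fin n × Fin n) ℂ)).rank :=
    (Matrix.rank_eq_finrank_span_row _).symm
  have hUcard : Module.finrank ℂ U ≤ _ := finrank_range_le_card _
  have hnf := card_normalForms_le n (l + 1)
  rw [hcard] at hsub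
  have e1 : l + 1 + 1 = l + 2 := rfl
  have e2 : l + 1 + 2 = l + 3 := rfl
  simp only [e1, e2] at hnf hUcard
  omega

theorem symmetricBorderRank_detForm_bound {n k l : ℕ} (h : k + (1 + l) = n) (hl : 2 ≤ l) {r : ℕ}
    (hr : symmetricBorderRank (detForm n) = r) :
    n.choose (l + 1) ^ 2 * (n ^ 2).choose 2 + n.choose (l + 3) ^ 2 ≤
      r * (n ^ 2 - 1).choose 2 + n ^ 2 * n.choose (l + 2) ^ 2 := by
  have h1 := le_rank_koszulMatrix_detForm h hl
  have h2 := rank_koszulMatrix_le_of_symmetricBorderRank_eq h hr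
  rw [Fintype.card_prod, Fintype.card_fin, ← sq] at h2
  omega

/-! ### The explicit bounds. -/

theorem choose_succ_cast (n k : ℕ) (h : k ≤ n) :
    (n.choose (k + 1) : ℝ) = n.choose k * ((n : ℝ) - k) / (k + 1) := by
  have hk : ((k : ℝ) + 1) ≠ 0 := by positivity
  rw [eq_div_iff hk]
  have := congrArg (Nat.cast (R := ℝ)) (Nat.choose_succ_right_eq n k)
  push_cast [Nat.cast_sub h] at this
  exact this

theorem symmetricBorderRank_detForm_bound_cast {n k l : ℕ} (h : k + (1 + l) = n) (hl : 2 ≤ l)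
    {r : ℕ} (hr : symmetricBorderRank (detForm n) = r) :
    (n.choose (l + 1) : ℝ) ^ 2 * ((n : ℝ) ^ 2 * ((n : ℝ) ^ 2 - 1) / 2) + (n.choose (l + 3) : ℝ) ^ 2 -
      (n : ℝ) ^ 2 * (n.choose (l + 2) : ℝ) ^ 2 ≤
      r * (((n : ℝ) ^ 2 - 1) * ((n : ℝ) ^ 2 - 2) / 2) := by
  have hb := (Nat.cast_le (α := ℝ)).2 (symmetricBorderRank_detForm_bound h hl hr)
  have hn : 1 ≤ n ^ 2 := Nat.one_le_pow _ _ (by omega)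
  push_cast [Nat.cast_choose_two, Nat.cast_sub hn] at hb
  linarith

theorem symmetricBorderRank_detForm_even_bound {p : ℕ} (hp : 3 ≤ p) {r : ℕ}
    (hr : symmetricBorderRank (detForm (p + p)) = r) :
    (1 + 8 * (((p + p : ℕ) : ℝ) ^ 3 + 6 * ((p + p : ℕ) : ℝ) ^ 2 - 8) /
      ((((p + p : ℕ) : ℝ) - 1) * (((p + p : ℕ) : ℝ) + 2) * (((p + p : ℕ) : ℝ) + 4) ^ 2 *
        (((p + p : ℕ) : ℝ) ^ 2 - 2))) * ((p + p).choose p : ℝ) ^ 2 ≤ (r : ℝ) := by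
  obtain ⟨l, rfl⟩ : ∃ l, p = l + 1 := ⟨p - 1, by omega⟩
  -- With n = 2p the choice k = p, l = p − 1 makes C(n, l+1) the central binomial coefficient; the
  -- requirement l ≥ 2 means n ≥ 6.
  have hb := symmetricBorderRank_detForm_bound_cast (k := l + 1) (l := l) (by omega) (by omega) hr
  rw [choose_succ_cast _ (l + 2) (by omega), choose_succ_cast _ (l + 1) (by omega)] at hb
  set c : ℝ := ((l + 1 + (l + 1)).choose (l + 1) : ℝ)
  have hq : (3 : ℝ) ≤ (l : ℝ) + 1 := by exact_mod_cast hp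
  push_cast at hb ⊢
  set q : ℝ := (l : ℝ) + 1 with hqdef
  have hl : (l : ℝ) = q - 1 := by rw [hqdef]; ring
  rw [hl] at hb
  rw [← two_mul] at hb ⊢
  have e1 : 2 * q - 1 ≠ 0 := by linarith
  have e2 : 2 * q + 2 ≠ 0 := by linarith
  have e3 : 2 * q + 4 ≠ 0 := by linarith
  have p1 : 0 < (2 * q) ^ 2 - 1 := by nlinarith
  have p2 : 0 < (2 * q) ^ 2 - 2 := by nlinarith
  have e6 : q - 1 + 2 + 1 ≠ 0 := by linarith
  have e7 : q + 1 ≠ 0 := by linarith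
  refine le_of_mul_le_mul_right (le_trans (le_of_eq ?_) hb)
    (by positivity : 0 < ((2 * q) ^ 2 - 1) * ((2 * q) ^ 2 - 2) / 2)
  have e8 : 2 * q ^ 2 - 1 ≠ 0 := by nlinarith
  field_simp
  ring

theorem symmetricBorderRank_detForm_odd_bound {p : ℕ} (hp : 2 ≤ p) {r : ℕ}
    (hr : symmetricBorderRank (detForm (2 * p + 1)) = r) :
    (1 + 16 * (((2 * p + 1 : ℕ) : ℝ) ^ 2 + 8 * ((2 * p + 1 : ℕ) : ℝ) + 9) /
      ((((2 * p + 1 : ℕ) : ℝ) + 3) * (((2 * p + 1 : ℕ) : ℝ) + 5) ^ 2 *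
        (((2 * p + 1 : ℕ) : ℝ) ^ 2 - 2))) * ((2 * p + 1).choose p : ℝ) ^ 2 ≤ (r : ℝ) := by
  -- With n = 2p + 1 the choice k = l = p gives C(n, p+1) = C(n, p), and l ≥ 2 means n ≥ 5.
  have hb := symmetricBorderRank_detForm_bound_cast (k := p) (l := p) (by omega) hp hr
  rw [choose_succ_cast _ (p + 2) (by omega), choose_succ_cast _ (p + 1) (by omega),
    choose_succ_cast _ p (by omega)] at hb
  set c : ℝ := ((2 * p + 1).choose p : ℝ)
  have hq : (2 : ℝ) ≤ (p : ℝ) := by exact_mod_cast hp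
  push_cast at hb ⊢
  set q : ℝ := (p : ℝ)
  have e2 : 2 * q + 1 + 3 ≠ 0 := by linarith
  have e3 : 2 * q + 1 + 5 ≠ 0 := by linarith
  have p1 : 0 < (2 * q + 1) ^ 2 - 1 := by nlinarith
  have p2 : 0 < (2 * q + 1) ^ 2 - 2 := by nlinarith
  have e6 : q + 2 + 1 ≠ 0 := by linarith
  have e7 : q + 1 ≠ 0 := by linarith
  have e9 : q + 1 + 1 ≠ 0 := by linarith
  refine le_of_mul_le_mul_right (le_trans (le_of_eq ?_) hb)
    (by positivity : 0 < ((2 * q + 1) ^ 2 - 1) * ((2 * q + 1) ^ 2 - 2) / 2)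
  have e8 := p2.ne'
  field_simp
  ring

theorem theorem1p3 (n : ℕ) (hn : 5 ≤ n) :
    ∃ r : ℕ, symmetricBorderRank (detForm n) = (r : ℕ∞) ∧
      (Even n →
        (1 + 8 * ((n : ℝ) ^ 3 + 6 * (n : ℝ) ^ 2 - 8) /
            (((n : ℝ) - 1) * ((n : ℝ) + 2) * ((n : ℝ) + 4) ^ 2 * ((n : ℝ) ^ 2 - 2))) *
          (n.choose (n / 2) : ℝ) ^ 2 ≤ (r : ℝ)) ∧
      (Odd n →
        (1 + 16 * ((n : ℝ) ^ 2 + 8 * (n : ℝ) + 9) /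
            (((n : ℝ) + 3) * ((n : ℝ) + 5) ^ 2 * ((n : ℝ) ^ 2 - 2))) *
          (n.choose ((n - 1) / 2) : ℝ) ^ 2 ≤ (r : ℝ)) := by
  obtain ⟨r, hr⟩ := exists_symmetricBorderRank_detForm_eq (n := n) (by omega)
  refine ⟨r, hr, ?_, ?_⟩
  · rintro ⟨p, rfl⟩
    rw [show (p + p) / 2 = p by omega]
    exact symmetricBorderRank_detForm_even_bound (by omega) hr
  · rintro ⟨p, rfl⟩
    rw [show (2 * p + 1 - 1) / 2 = p by omega]
    exact symmetricBorderRank_detForm_odd_bound (by omega) hr
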